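/- Let $G=(V,E)$ be a finite simple undirected graph with $n$ vertices and maximum degree $\Delta$, and let $\chi$ be a (proper) partial edge coloring of $G$ with the colors $1,\dots,\Delta+1$ that leaves the edge $(u,v)\in E$ uncolored (other edges may be uncolored too). Write $\mathsf{miss}_\chi(w)$ for the set of colors not used by $\chi$ around $w$. Put $\ell = 10^2\log n$ (natural logarithm) and $L=\lceil 10^3\ell^2(\Delta^2+\sqrt{\Delta n})\rceil$, and let $c_u\in\mathsf{miss}_\chi(u)$, $c_v\in\mathsf{miss}_\chi(v)$. Consider the following algorithm $\mathsf{ExtendColoring}(\chi,u,v)$. In each iteration, with current data $(\chi,u,v,c_u,c_v)$: 1. *Fan.* Let $v_0=v$ and $c_0\in\mathsf{miss}_\chi(v_0)\setminus\{c_v\}$. As long as, for the current index $i$, $c_i\notin\{c_0,\dots,c_{i-1}\}$ and $c_i\notin\mathsf{miss}_\chi(u)$, let $(u,v_{i+1})$ be the edge of color $c_i$, and let $c_{i+1}=c_u$ if $c_u\in\mathsf{miss}_\chi(v_{i+1})$ and $c_{i+1}\in\mathsf{miss}_\chi(v_{i+1})$ otherwise. Let $k$ be the last index. If $c_k\in\mathsf{miss}_\chi(u)$,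 set $\chi(u,v_j)\leftarrow c_j$ for $j=0,\dots,k$ and return $\chi$. 2. *Path.* Otherwise let $j$ be the first index with $c_j=c_k$. If $c_k\ne c_v$, let $c\in\mathsf{miss}_\chi(u)\setminus\{c_u\}$, $\{a,b\}=\{c,c_k\}$, and let $P$ be the maximal $\{a,b\}$-alternating path starting at $u$. If $c_k=c_v$, let $\{a,b\}=\{c_u,c_v\}$ and let $P$ be the maximal $\{a,b\}$-alternating path starting at $v_j$. 3. *Short path.* If $P$ has at most $2L+2$ edges, extend $\chi$ to $(u,v)$ as in Vizing's algorithm, by flipping the colors of $P$ and shifting colors around $u$, and return the result. (That is: if $c_k\neq c_v$ and $P$ does not end at $v_j$, set $\chi(u,v_i)\leftarrow c_i$ for $i\le j$ and flip $P$; if $c_k=c_v$ and $P$ does not end at $u$, set $\chi(u,v_i)\leftarrow c_i$ for $i<j$, flip $P$ and set $\chi(u,v_j)\leftarrow c_u$; in the remaining cases flip $P$, then set $\chi(u,v_i)\leftarrow\chi(u,v_{i+1})$ for $i=0,\dots,k-1$, and $\chi(u,v_k)\leftarrow c_k$.) 4. *Truncation.* Otherwise sample $i\in\{1,\dots,L\}$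 uniformly at random, independently of all other samples, and let $t=i+1$. If $c_k\neq c_v$, set $\chi(u,v_{m})\leftarrow c_{m}$ for $m\le j$; if $c_k=c_v$, set $\chi(u,v_{m})\leftarrow c_{m}$ for $m<j$ and $\chi(u,v_j)\leftarrow c_u$. Flip the colors of the first $t-1$ edges of $P$, and uncolor its $t$-th edge $(u',v')$, where $u'$ is the $t$-th and $v'$ the $(t+1)$-st vertex of $P$. Let $c_u'\in\mathsf{miss}_\chi(u')\cap\{a,b\}$ and $c_v'\in\mathsf{miss}_\chi(v')\cap\{a,b\}$, and continue with the next iteration on $(\chi,u',v',c_u',c_v')$. All choices of the form "let $c\in S$" are arbitrary; they may depend on the current data and on the samples drawn in earlier iterations. Then, however these choices are made, the algorithm terminates within $\ell+1$ iterations with probability at least $1/(160\log n)$. -/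

import Mathlib

namespace ExtendColoring

section

variable {V : Type*} {q : ℕ}

/-- An assignment of colors from `{0, …, q - 1}` to edges; `none` means "uncolored". -/
abbrev Coloring (V : Type*) (q : ℕ) := Sym2 V → Option (Fin q)

/-- `χ` is a (proper) partial edge coloring of `G`: only edges of `G` receive colors, and two
different edges at a common vertex never receive the same color. -/
structure IsPartialColoring (G : SimpleGraph V) (χ : Coloring V q) : Prop where
  support : ∀ e c, χ e = some c → e ∈ G.edgeSet
  proper : ∀ u v w c, χ s(u, v) = some c → χ s(u, w) = some c → v = w

/-- The colors that are not used around `u`. -/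
def miss [Fintype V] (χ : Coloring V q) (u : V) : Finset (Fin q) :=
  Finset.univ.filter fun c => ∀ w, χ s(u, w) ≠ some c

open Classical in
/-- The vertex `w` for which the edge `(u, w)` has color `c` (only used when there is one, and
then it is unique). -/
noncomputable def nbr (χ : Coloring V q) (u : V) (c : Fin q) : V :=
  if h : ∃ w, χ s(u, w) = some c then h.choose else u

/-! ### Alternating paths -/

/-- A path given by its vertices `vert 0, …, vert length` (the values of `vert` beyond `length` are
irrelevant), whose edges are colored alternately `fst, snd, fst, …`. Its `j`-th edge,
`j = 1, …, length`, is `(vert (j - 1), vert j)`. -/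
structure AltPath (V : Type*) (q : ℕ) where
  vert : ℕ → V
  length : ℕ
  fst : Fin q
  snd : Fin q

/-- The vertices met when one starts at `s` and follows edges of colors `a, b, a, b, …`. -/
noncomputable def altVert (χ : Coloring V q) (s : V) (a b : Fin q) : ℕ → V
  | 0 => s
  | j + 1 => nbr χ (altVert χ s a b j) (if Even j then a else b)

/-- The maximal `{a, b}`-alternating path under `χ` which starts at `s`, where `s` misses `b` (so
that its first edge, if any, has color `a`): it is followed until the next color is missing. -/
noncomputable def altPath [Fintype V] (χ : Coloring V q) (s : V) (a b : Fin q) : AltPath V q where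
  vert := altVert χ s a b
  length := sInf {j | (if Even j then a else b) ∈ miss χ (altVert χ s a b j)}
  fst := a
  snd := b

open Classical in
/-- Exchange the two colors of the path on its first `m` edges. -/
noncomputable def flip (χ : Coloring V q) (P : AltPath V q) (m : ℕ) : Coloring V q := fun e =>
  if ∃ j < m, e = s(P.vert j, P.vert (j + 1)) then (χ e).map (Equiv.swap P.fst P.snd) else χ e

/-! ### The state of the algorithm and its arbitrary choices -/

/-- The input of an iteration: a coloring `χ`, an uncolored edge `(u, v)`, and colors `cu`, `cv`
missing at `u` and at `v`. -/
structure State (V : Type*) (q : ℕ) where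
  χ : Coloring V q
  u : V
  v : V
  cu : Fin q
  cv : Fin q

/-- The places within an iteration at which a color is chosen from a set in an unspecified way:
the color of the `i`-th vertex of the fan, the second color `c` of the path which starts at `u`,
and the colors `cu'` and `cv'` returned by a truncation. -/
inductive ChoicePoint where
  | fan (i : ℕ)
  | path
  | endU
  | endV

/-- A way to make the choices "let `c ∈ S`" of one iteration. -/
abbrev Choice (q : ℕ) := ChoicePoint → Finset (Fin q) → Fin q

variable [Fintype V] [DecidableEq V] (pick : Choice q) (s : State V q)

/-! ### Vizing fans -/

open Classical in
/-- The sequence `(v₀, c₀), (v₁, c₁), …` built by the fan construction; only its terms with index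
at most `fanLast` are ever used. -/
noncomputable def fan : ℕ → V × Fin q
  | 0 => (s.v, pick (.fan 0) (miss s.χ s.v \ {s.cv}))
  | i + 1 =>
    let w := nbr s.χ s.u (fan i).2
    (w, if s.cu ∈ miss s.χ w then s.cu else pick (.fan (i + 1)) (miss s.χ w))

/-- The vertex `v_i` of the fan. -/
noncomputable def fanV (i : ℕ) : V := (fan pick s i).1

/-- The color `c_i` of the fan. -/
noncomputable def fanC (i : ℕ) : Fin q := (fan pick s i).2

/-- The last index `k` of the fan: the first one at which the loop
"while `c_i ∉ {c_0, …, c_{i-1}}` and `c_i ∉ miss(u)`" is left. -/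
noncomputable def fanLast : ℕ :=
  sInf {i | (∃ j < i, fanC pick s j = fanC pick s i) ∨ fanC pick s i ∈ miss s.χ s.u}

/-- The fan construction itself extends the coloring. -/
def FanExtends : Prop := fanC pick s (fanLast pick s) ∈ miss s.χ s.u

/-- The fan is `cv`-primed. -/
def Primed : Prop := fanC pick s (fanLast pick s) = s.cv

/-- The index of the first appearance of the last color `c_k` among `c_0, …, c_k`. -/
noncomputable def pivot : ℕ := sInf {j | fanC pick s j = fanC pick s (fanLast pick s)}

/-- `χ(u, v_j) ← c_j` for `j = 0, …, m - 1`. -/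
noncomputable def shiftFan : ℕ → Coloring V q
  | 0 => s.χ
  | m + 1 => Function.update (shiftFan m) s(s.u, fanV pick s m) (some (fanC pick s m))

/-- `χ'(u, v_j) ← χ'(u, v_{j+1})` for `j = 0, …, m - 1`, one after the other, starting with a
coloring `χ'`. -/
noncomputable def shiftFanFrom (χ' : Coloring V q) : ℕ → Coloring V q
  | 0 => χ'
  | m + 1 => Function.update (shiftFanFrom χ' m) s(s.u, fanV pick s m)
      (shiftFanFrom χ' m s(s.u, fanV pick s (m + 1)))

/-! ### Vizing chains -/

open Classical in
/-- The maximal alternating path considered by the algorithm `Vizing` when the fan construction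
does not extend the coloring. If the fan is not `cv`-primed, this is the `{c, c_k}`-alternating path
which starts at `u`, for a color `c ∈ miss(u) \ {cu}`; otherwise it is the `{cu, cv}`-alternating
path which starts at `v_i`, where `c_i` is the first appearance of `cv = c_k`. -/
noncomputable def vizingPath : AltPath V q :=
  if Primed pick s then
    altPath s.χ (fanV pick s (pivot pick s)) s.cu s.cv
  else
    altPath s.χ s.u (fanC pick s (fanLast pick s)) (pick .path (miss s.χ s.u \ {s.cu}))

open Classical in
/-- The coloring returned by the algorithm `Vizing`, with `k = fanLast` and `j = pivot`:
* if the fan construction extends the coloring, `χ(u, v_i) ← c_i` for `i ≤ k`;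
* if the fan is not `cv`-primed and `P` does not end at `v_j`, `χ(u, v_i) ← c_i` for `i ≤ j`, and `P`
  is flipped;
* if the fan is `cv`-primed and `P` does not end at `u`, `χ(u, v_i) ← c_i` for `i < j`, `P` is
  flipped, and `χ(u, v_j) ← cu`;
* in the two remaining cases `P` is flipped, then `χ(u, v_i) ← χ(u, v_{i+1})` for `i < k`, and
  `χ(u, v_k) ← c_k`. -/
noncomputable def vizing : Coloring V q :=
  let k := fanLast pick s
  let j := pivot pick s
  let P := vizingPath pick s
  if FanExtends pick s then
    shiftFan pick s (k + 1)
  else if ¬ Primed pick s ∧ P.vert P.length ≠ fanV pick s j then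
    flip (shiftFan pick s (j + 1)) P P.length
  else if Primed pick s ∧ P.vert P.length ≠ s.u then
    Function.update (flip (shiftFan pick s j) P P.length) s(s.u, fanV pick s j) (some s.cu)
  else
    Function.update (shiftFanFrom pick s (flip s.χ P P.length) k) s(s.u, fanV pick s k)
      (some (fanC pick s k))

open Classical in
/-- The algorithm `TruncatedVizing`. If the path `P` considered by `Vizing` has at most `t` edges (or
if there is none), it returns the coloring returned by `Vizing`. Otherwise it shifts the
colors of the fan up to the start of `P`, flips the first `t - 1` edges of `P`, uncolors the `t`-th
edge `(u', v')`, and returns the new state. (If the fan is not primed, the first edge of `P` is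
`(u, v_{j+1})`, with `j` the first index such that `c_j = c_k`.) -/
noncomputable def truncatedVizing (t : ℕ) : State V q ⊕ Coloring V q :=
  let j := pivot pick s
  let P := vizingPath pick s
  if FanExtends pick s ∨ P.length ≤ t then
    .inr (vizing pick s)
  else
    let χ₁ : Coloring V q :=
      if Primed pick s then
        Function.update (shiftFan pick s j) s(s.u, fanV pick s j) (some s.cu)
      else
        shiftFan pick s (j + 1)
    let u' := P.vert (t - 1)
    let v' := P.vert t
    let χ₂ : Coloring V q := Function.update (flip χ₁ P (t - 1)) s(u', v') none
    .inl
      { χ := χ₂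
        u := u'
        v := v'
        cu := pick .endU (miss χ₂ u' ∩ {P.fst, P.snd})
        cv := pick .endV (miss χ₂ v' ∩ {P.fst, P.snd}) }

/-! ### The algorithm `ExtendColoring` -/

open Classical in
/-- One iteration of the loop with parameter `L` and sample `i`; the loop either
continues with a new state or returns a coloring. -/
noncomputable def iteration (L i : ℕ) : State V q ⊕ Coloring V q :=
  if FanExtends pick s ∨ (vizingPath pick s).length ≤ 2 * L + 2 then
    .inr (vizing pick s)
  else
    truncatedVizing pick s (i + 1)

/-- The first `m` iterations of the algorithm which is started in the state `s`, when the samples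
drawn in iterations `1, 2, …` are `x 0 + 1, x 1 + 1, … ∈ {1, …, L}`. The arbitrary choices of an
iteration may depend on the samples drawn in all earlier iterations. -/
noncomputable def run {L : ℕ} (pick : List (Fin L) → Choice q) (s : State V q) (x : ℕ → Fin L) :
    ℕ → State V q ⊕ Coloring V q
  | 0 => .inl s
  | m + 1 =>
    match run pick s x m with
    | .inl s' => iteration (pick ((List.range m).map x)) s' L (x m + 1)
    | .inr χ => .inr χ

/-- The algorithm returns a coloring after at most `m` iterations. -/
def TerminatesWithin {L : ℕ} (pick : List (Fin L) → Choice q) (s : State V q) (x : ℕ → Fin L)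
    (m : ℕ) : Prop :=
  ∃ χ, run pick s x m = .inr χ

end

/-- The parameter `ℓ = 10² log n`. -/
noncomputable def ell (n : ℕ) : ℝ := 10 ^ 2 * Real.log n

/-- The parameter `L = 10³ ℓ² (Δ² + √(Δ n))`, rounded up to an integer. -/
noncomputable def truncLen (n Δ : ℕ) : ℕ :=
  ⌈10 ^ 3 * ell n ^ 2 * ((Δ : ℝ) ^ 2 + √((Δ : ℝ) * n))⌉₊

end ExtendColoring

/-!
The algorithm survives `ℓ + 1` iterations with probability at most `1 / 2`.

Call the path of an iteration *long* if the iteration does not return. After a truncation of a path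
with colors `{a, b}`, the colors `cu` and `cv` are `a` and `b`, and `cv` is seen at the new center
(`iteration_valid`). Hence the next path either is primed, with colors `{a, b}` again, or it starts
at the new center and avoids `a` and `b`. In the second case it is a path of a coloring that does
not depend on the sample of the truncation (`IsStep.next_walk`).

Fix all samples but one. Different values of this sample lead to different centers. Each long path
occupies more than `2 L + 2` vertices, and a graph of maximum degree two has few ends of components
of that size (`card_mul_le_of_paths`). So only `O(Δ n / L)` values lead to a long primed path, and
only `O(ℓ Δ n / L)` lead to a long path that shares a color with one of the earlier paths. Here it
matters that `L² ≥ ℓ⁴ Δ n`, up to a constant. Moreover, a path is determined by its colors, one of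
its vertices, and the parity of the position of this vertex (`IsAltWalk.unique`), so that
only `O(ℓ Δ²)` values lead to a path that meets an earlier center or starts next to one. Together,
the unfavorable values form a small fraction of `1 / ℓ` (`IsStep.card_bad_mul_le`), and with high
probability none occurs in `ℓ + 1` iterations.

If none occurs, each path after the first is an alternating path of the *initial* coloring, and its
start misses the second color there (`Goes.walk_initial`). Then every center is determined by the
next one together with two colors and a parity, and the samples are determined by the centers
(`samples_eq`). This leaves at most `n (2 (Δ + 1)²) ^ m` tuples of `m` samples, which is a tiny
fraction of `L ^ m` since `L ≥ 1000 ℓ² Δ²`.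
-/

namespace ExtendColoring

/-! ### Alternating walks -/

section Walks

variable {V : Type*} {q : ℕ}

/-- The color of the edge that leaves the vertex with index `j` on a path whose edges are colored
`a, b, a, b, …`. -/
abbrev altColor (a b : Fin q) (j : ℕ) : Fin q := if Even j then a else b

lemma altColor_congr (a b : Fin q) {i j : ℕ} (h : Even i ↔ Even j) :
    altColor a b i = altColor a b j := by
  simp only [altColor, h]

lemma altColor_eq_or (a b : Fin q) (j : ℕ) : altColor a b j = a ∨ altColor a b j = b := by
  by_cases h : Even j <;> simp [altColor, h]

lemma swap_altColor (a b : Fin q) (j : ℕ) :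
    Equiv.swap a b (altColor a b j) = altColor a b (j + 1) := by
  by_cases h : Even j <;> simp [altColor, h, Nat.even_add_one]

lemma altColor_succ_ne {a b : Fin q} (hab : a ≠ b) (j : ℕ) :
    altColor a b (j + 1) ≠ altColor a b j := by
  by_cases h : Even j <;> simp [altColor, h, Nat.even_add_one, hab, hab.symm]

lemma altColor_eq_or_succ (a b : Fin q) {c : Fin q} (hc : c = a ∨ c = b) (j : ℕ) :
    c = altColor a b j ∨ c = altColor a b (j + 1) := by
  by_cases h : Even j <;> simp [altColor, h, Nat.even_add_one] <;> tauto

/-- The first `r` edges `(f j, f (j + 1))` are colored `a, b, a, b, …` by `χ`. -/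
def IsAltWalk (χ : Coloring V q) (f : ℕ → V) (a b : Fin q) (r : ℕ) : Prop :=
  ∀ j < r, χ s(f j, f (j + 1)) = some (altColor a b j)

lemma IsAltWalk.mono {χ : Coloring V q} {f : ℕ → V} {a b : Fin q} {r r' : ℕ}
    (h : IsAltWalk χ f a b r) (hr : r' ≤ r) : IsAltWalk χ f a b r' :=
  fun j hj => h j (hj.trans_le hr)

lemma IsPartialColoring.adj {G : SimpleGraph V} {χ : Coloring V q} (hχ : IsPartialColoring G χ)
    {x y : V} {c : Fin q} (h : χ s(x, y) = some c) : G.Adj x y :=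
  hχ.support _ _ h

variable [Fintype V]

@[simp] lemma mem_miss {χ : Coloring V q} {u : V} {c : Fin q} :
    c ∈ miss χ u ↔ ∀ w, χ s(u, w) ≠ some c := by
  simp [miss]

lemma nbr_spec {χ : Coloring V q} {u : V} {c : Fin q} (h : c ∉ miss χ u) :
    χ s(u, nbr χ u c) = some c := by
  have h' : ∃ w, χ s(u, w) = some c := by simpa using h
  rw [nbr, dif_pos h']
  exact h'.choose_spec

lemma altPath_isAltWalk (χ : Coloring V q) (s : V) (a b : Fin q) :
    IsAltWalk χ (altPath χ s a b).vert a b (altPath χ s a b).length := by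
  intro j hj
  exact nbr_spec (Nat.notMem_of_lt_sInf hj)

variable {G : SimpleGraph V} {χ : Coloring V q}

/-- A walk that starts at a vertex missing its second color can be traced back from its last
vertex, once the two colors and the parity of the length are known. -/
lemma IsAltWalk.unique (hχ : IsPartialColoring G χ) {a b : Fin q} {f g : ℕ → V} {r r' : ℕ}
    (hf : IsAltWalk χ f a b r) (hg : IsAltWalk χ g a b r') (hfb : b ∈ miss χ (f 0))
    (hgb : b ∈ miss χ (g 0)) (hpar : Even r ↔ Even r') (h : f r = g r') :
    r = r' ∧ f 0 = g 0 := by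
  have key : ∀ {f g : ℕ → V} {r : ℕ}, IsAltWalk χ g a b (r + 1) → b ∈ miss χ (f 0) →
      Even (r + 1) → f 0 ≠ g (r + 1) := by
    intro f g r hg hf hr h
    have h1 := hg r (Nat.lt_succ_self r)
    rw [← h, Sym2.eq_swap, altColor, if_neg (by simpa [Nat.even_add_one] using hr)] at h1
    exact mem_miss.1 hf _ h1
  induction r generalizing r' with
  | zero =>
    cases r' with
    | zero => exact ⟨rfl, h⟩
    | succ r' => exact absurd h (key hg hfb (hpar.1 (by simp)))
  | succ r ih =>
    cases r' with
    | zero => exact absurd h.symm (key hf hgb (hpar.2 (by simp)))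
    | succ r' =>
      have hpar' : Even r ↔ Even r' := by
        rw [Nat.even_add_one, Nat.even_add_one] at hpar
        exact not_iff_not.1 hpar
      have h1 := hf r (Nat.lt_succ_self r)
      have h2 := hg r' (Nat.lt_succ_self r')
      rw [Sym2.eq_swap, altColor_congr a b hpar'] at h1
      rw [Sym2.eq_swap, ← h] at h2
      have h3 := ih (hf.mono (Nat.le_succ r)) (hg.mono (Nat.le_succ r')) hpar'
        (hχ.proper _ _ _ _ h1 h2)
      exact ⟨by omega, h3.2⟩

/-- A walk that starts at a vertex missing its second color is a path. -/
lemma IsAltWalk.injOn (hχ : IsPartialColoring G χ) {a b : Fin q} {f : ℕ → V} {r : ℕ}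
    (hf : IsAltWalk χ f a b r) (hfb : b ∈ miss χ (f 0)) {i j : ℕ} (hi : i ≤ r) (hj : j ≤ r)
    (h : f i = f j) : i = j := by
  -- Vertices at an odd distance along the walk: the two ends approach each other until they
  -- would span a loop.
  have odd : ∀ d i, i + 1 + 2 * d ≤ r → f i ≠ f (i + 1 + 2 * d) := by
    intro d
    induction d with
    | zero =>
      intro i hi h
      have h1 := hf i (by omega)
      rw [← show f i = f (i + 1) from h] at h1
      exact (hχ.adj h1).ne rfl
    | succ d ih =>
      intro i hi h
      have h1 := hf i (by omega)
      have h2 := hf (i + 1 + 2 * d + 1) (by omega)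
      rw [Sym2.eq_swap, show i + 1 + 2 * d + 1 + 1 = i + 1 + 2 * (d + 1) by ring, ← h,
        altColor_congr a b (show Even (i + 1 + 2 * d + 1) ↔ Even i by
          simp [Nat.even_add_one, Nat.even_add])] at h2
      refine ih (i + 1) (by omega) ?_
      rw [hχ.proper _ _ _ _ h1 h2]
      congr 1
      omega
  by_cases hpar : Even i ↔ Even j
  · exact ((hf.mono hi).unique hχ (hf.mono hj) hfb hfb hpar h).1
  · exfalso
    rcases lt_trichotomy i j with hij | hij | hij
    · obtain ⟨d, rfl⟩ : ∃ d, j = i + 1 + 2 * d := by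
        refine ⟨(j - i) / 2, ?_⟩
        rw [Nat.even_iff, Nat.even_iff] at hpar
        omega
      exact odd d i hj h
    · exact hpar (by rw [hij])
    · obtain ⟨d, rfl⟩ : ∃ d, i = j + 1 + 2 * d := by
        refine ⟨(i - j) / 2, ?_⟩
        rw [Nat.even_iff, Nat.even_iff] at hpar
        omega
      exact odd d j hi h.symm

/-- An interior vertex of an alternating walk sees both colors. -/
lemma IsAltWalk.notMem_miss {a b c : Fin q} {f : ℕ → V} {r j : ℕ}
    (hf : IsAltWalk χ f a b r) (h0 : 0 < j) (hj : j < r) (hc : c = a ∨ c = b) :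
    c ∉ miss χ (f j) := by
  obtain ⟨j, rfl⟩ : ∃ i, j = i + 1 := ⟨j - 1, by omega⟩
  intro h
  rw [mem_miss] at h
  rcases altColor_eq_or_succ a b hc j with rfl | rfl
  · exact h _ (by rw [Sym2.eq_swap]; exact hf j (by omega))
  · exact h _ (hf (j + 1) hj)

end Walks

/-! ### Truncated Vizing chains -/

section Chain

variable {V : Type*} {q : ℕ}

/-- The coloring produced by a truncation from the coloring `χ₁` with shifted fan: the first `i`
edges of `P` are flipped, and the next one loses its color. -/
noncomputable def truncColoring [DecidableEq V] (χ₁ : Coloring V q) (P : AltPath V q) (i : ℕ) :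
    Coloring V q :=
  Function.update (flip χ₁ P i) s(P.vert i, P.vert (i + 1)) none

/-- A truncation does not change which edges have a color of the path, apart from the fan and the
edge that loses its color. -/
lemma truncColoring_mem_iff [DecidableEq V] {χ₁ : Coloring V q} {P : AltPath V q}
    {i : ℕ} {e : Sym2 V} :
    (truncColoring χ₁ P i e = some P.fst ∨ truncColoring χ₁ P i e = some P.snd) ↔
      e ≠ s(P.vert i, P.vert (i + 1)) ∧ (χ₁ e = some P.fst ∨ χ₁ e = some P.snd) := by
  by_cases he : e = s(P.vert i, P.vert (i + 1))
  · subst he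
    simp [truncColoring]
  · have hflip : (flip χ₁ P i e = some P.fst ∨ flip χ₁ P i e = some P.snd) ↔
        (χ₁ e = some P.fst ∨ χ₁ e = some P.snd) := by
      unfold flip
      split_ifs
      · simp only [Option.map_eq_some_iff, Equiv.swap_apply_eq_iff, Equiv.swap_apply_left,
          Equiv.swap_apply_right, exists_eq_right]
        exact or_comm
      · rfl
    rw [truncColoring, Function.update_of_ne he, hflip]
    simp [he]

variable [Fintype V]

/-- The combinatorial data of a truncated Vizing chain, in a form that covers both kinds of chains.
The vertices `v 0, …, v j` form a fan around `u`, and `χ₁` arises from `χ` by giving the color `c m`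
to the edge `(u, v m)` for `m ≤ j`. The alternating path `P`, of which `N` edges are considered,
starts at one of the vertices `u` and `v j`; the other one is called `o`. -/
structure IsVizingChain (G : SimpleGraph V) (χ χ₁ : Coloring V q) (u : V) (v : ℕ → V)
    (c : ℕ → Fin q) (j : ℕ) (o : V) (P : AltPath V q) (N : ℕ) : Prop where
  coloring : IsPartialColoring G χ
  adj : ∀ m ≤ j, G.Adj u (v m)
  vert_inj : ∀ m ≤ j, ∀ m' ≤ j, v m = v m' → m = m'
  uncolored : χ s(u, v 0) = none
  colored : ∀ m < j, χ s(u, v (m + 1)) = some (c m)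
  missing : ∀ m < j, c m ∈ miss χ (v m)
  color_inj : ∀ m < j, ∀ m' < j, c m = c m' → m = m'
  color_ne : ∀ m < j, c m ≠ P.fst ∧ c m ≠ P.snd
  color_last : c j = P.fst
  fst_ne_snd : P.fst ≠ P.snd
  walk : IsAltWalk χ P.vert P.fst P.snd N
  start_miss : P.snd ∈ miss χ (P.vert 0)
  ends : (P.vert 0 = u ∧ o = v j) ∨ (P.vert 0 = v j ∧ o = u)
  other_miss : P.fst ∈ miss χ o
  shift_fan : ∀ m ≤ j, χ₁ s(u, v m) = some (c m)
  shift_other : ∀ e, (∀ m ≤ j, e ≠ s(u, v m)) → χ₁ e = χ e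

namespace IsVizingChain

variable {G : SimpleGraph V} {χ χ₁ : Coloring V q} {u : V} {v : ℕ → V}
    {c : ℕ → Fin q} {j : ℕ} {o : V} {P : AltPath V q} {N : ℕ}

lemma vert_injOn (h : IsVizingChain G χ χ₁ u v c j o P N) {r r' : ℕ} (hr : r ≤ N) (hr' : r' ≤ N)
    (he : P.vert r = P.vert r') : r = r' :=
  h.walk.injOn h.coloring h.start_miss hr hr' he

lemma other_notMem (h : IsVizingChain G χ χ₁ u v c j o P N) {r : ℕ} (hr : r < N) :
    P.vert r ≠ o := by
  intro he
  rcases Nat.eq_zero_or_pos r with rfl | h0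
  · rcases h.ends with ⟨h1, h2⟩ | ⟨h1, h2⟩
    · exact (h.adj j le_rfl).ne (by rw [← h1, he, h2])
    · exact (h.adj j le_rfl).ne (by rw [← h1, he, h2])
  · exact h.walk.notMem_miss h0 hr (Or.inl rfl) (by rw [he]; exact h.other_miss)

lemma edge_ne_fan (h : IsVizingChain G χ χ₁ u v c j o P N) {r m : ℕ} (hr : r < N) (hm : m ≤ j) :
    s(P.vert r, P.vert (r + 1)) ≠ s(u, v m) := by
  intro he
  have h1 := h.walk r hr
  rw [he] at h1
  cases m with
  | zero => rw [h.uncolored] at h1; cases h1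
  | succ m =>
    rw [h.colored m hm] at h1
    have h2 := h.color_ne m hm
    rcases altColor_eq_or P.fst P.snd r with h3 | h3
    · exact h2.1 ((Option.some.inj h1).trans h3)
    · exact h2.2 ((Option.some.inj h1).trans h3)

lemma shift_walk (h : IsVizingChain G χ χ₁ u v c j o P N) : IsAltWalk χ₁ P.vert P.fst P.snd N :=
  fun r hr => (h.shift_other _ fun _ hm => h.edge_ne_fan hr hm).trans (h.walk r hr)

/-- The color of an edge of the fan belongs to the path only for the last edge of the fan. -/
lemma fan_color (h : IsVizingChain G χ χ₁ u v c j o P N) {m : ℕ} (hm : m ≤ j)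
    (hc : c m = P.fst ∨ c m = P.snd) : m = j := by
  by_contra hne
  have := h.color_ne m (by omega)
  tauto

/-- Among the vertices of the path, only the first one is on the last edge of the fan. -/
lemma eq_zero_of_mem_last (h : IsVizingChain G χ χ₁ u v c j o P N) {r : ℕ} (hr : r < N)
    (he : P.vert r ∈ s(u, v j)) : r = 0 := by
  have ho := h.other_notMem hr
  refine h.vert_injOn hr.le (Nat.zero_le _) ?_
  rw [Sym2.mem_iff] at he
  rcases h.ends with ⟨h1, h2⟩ | ⟨h1, h2⟩
  · rcases he with he | he
    · rw [he, h1]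
    · exact absurd (he.trans h2.symm) ho
  · rcases he with he | he
    · exact absurd (he.trans h2.symm) ho
    · rw [he, h1]

/-- An edge at a vertex of the path which has one of its colors lies on the path. -/
lemma exists_edge (h : IsVizingChain G χ χ₁ u v c j o P N) {r : ℕ} (hr : r < N) {z : V}
    {d : Fin q} (hd : d = P.fst ∨ d = P.snd) (he : χ s(P.vert r, z) = some d) :
    ∃ r' ≤ r, s(P.vert r, z) = s(P.vert r', P.vert (r' + 1)) ∧ d = altColor P.fst P.snd r' := by
  rcases Nat.eq_zero_or_pos r with rfl | h0
  · rcases hd with rfl | rfl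
    · refine ⟨0, le_rfl, ?_, by simp [altColor]⟩
      rw [h.coloring.proper _ _ _ _ he (by simpa [altColor] using h.walk 0 hr)]
    · exact absurd he (mem_miss.1 h.start_miss z)
  · obtain ⟨r, rfl⟩ : ∃ i, r = i + 1 := ⟨r - 1, by omega⟩
    rcases altColor_eq_or_succ P.fst P.snd hd r with rfl | rfl
    · refine ⟨r, Nat.le_succ r, ?_, rfl⟩
      have h1 := h.walk r (by omega)
      rw [Sym2.eq_swap] at h1
      rw [h.coloring.proper _ _ _ _ he h1, Sym2.eq_swap]
    · refine ⟨r + 1, le_rfl, ?_, rfl⟩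
      rw [h.coloring.proper _ _ _ _ he (h.walk _ hr)]

variable [DecidableEq V]

lemma trunc_fan (h : IsVizingChain G χ χ₁ u v c j o P N) {i m : ℕ} (hi : i < N) (hm : m ≤ j) :
    truncColoring χ₁ P i s(u, v m) = some (c m) := by
  rw [truncColoring, Function.update_of_ne (h.edge_ne_fan hi hm).symm, flip, if_neg,
    h.shift_fan m hm]
  rintro ⟨r, hr, he⟩
  exact h.edge_ne_fan (hr.trans hi) hm he.symm

lemma trunc_walk (h : IsVizingChain G χ χ₁ u v c j o P N) {i r : ℕ} (hi : i < N) (hr : r < i) :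
    truncColoring χ₁ P i s(P.vert r, P.vert (r + 1)) = some (altColor P.fst P.snd (r + 1)) := by
  have hne : s(P.vert r, P.vert (r + 1)) ≠ s(P.vert i, P.vert (i + 1)) := by
    intro he
    have h1 : P.vert i ∈ s(P.vert r, P.vert (r + 1)) := by rw [he]; simp
    have h2 : P.vert (i + 1) ∈ s(P.vert r, P.vert (r + 1)) := by rw [he]; simp
    rw [Sym2.mem_iff] at h2
    rcases h2 with h2 | h2
    · have := h.vert_injOn (by omega) (by omega) h2; omega
    · have := h.vert_injOn (by omega) (by omega) h2; omega
  rw [truncColoring, Function.update_of_ne hne, flip, if_pos ⟨r, hr, rfl⟩,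
    h.shift_walk r (by omega), Option.map_some, swap_altColor]

lemma trunc_eq_of_notMem (h : IsVizingChain G χ χ₁ u v c j o P N) {i : ℕ} {e : Sym2 V}
    (hfan : ∀ m ≤ j, e ≠ s(u, v m)) (hw : ∀ r ≤ i, e ≠ s(P.vert r, P.vert (r + 1))) :
    truncColoring χ₁ P i e = χ e := by
  rw [truncColoring, Function.update_of_ne (hw i le_rfl), flip, if_neg, h.shift_other e hfan]
  rintro ⟨r, hr, he⟩
  exact hw r hr.le he

lemma trunc_cases (h : IsVizingChain G χ χ₁ u v c j o P N) {i : ℕ} (hi : i < N) {e : Sym2 V}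
    {d : Fin q} (he : truncColoring χ₁ P i e = some d) :
    (∃ m ≤ j, e = s(u, v m) ∧ d = c m) ∨
    (∃ r < i, e = s(P.vert r, P.vert (r + 1)) ∧ d = altColor P.fst P.snd (r + 1)) ∨
    ((∀ m ≤ j, e ≠ s(u, v m)) ∧ (∀ r ≤ i, e ≠ s(P.vert r, P.vert (r + 1))) ∧ χ e = some d) := by
  by_cases hfan : ∀ m ≤ j, e ≠ s(u, v m)
  · by_cases hw : ∀ r ≤ i, e ≠ s(P.vert r, P.vert (r + 1))
    · exact Or.inr (Or.inr ⟨hfan, hw, by rw [← h.trunc_eq_of_notMem hfan hw, he]⟩)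
    · push Not at hw
      obtain ⟨r, hr, rfl⟩ := hw
      rcases hr.lt_or_eq with hr | rfl
      · rw [h.trunc_walk hi hr] at he
        exact Or.inr (Or.inl ⟨r, hr, rfl, (Option.some.inj he).symm⟩)
      · simp [truncColoring] at he
  · push Not at hfan
    obtain ⟨m, hm, rfl⟩ := hfan
    rw [h.trunc_fan hi hm] at he
    exact Or.inl ⟨m, hm, rfl, (Option.some.inj he).symm⟩

/-- The truncated coloring is proper. -/
lemma isPartialColoring_trunc (h : IsVizingChain G χ χ₁ u v c j o P N) {i : ℕ} (h0 : 0 < i)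
    (hi : i < N) : IsPartialColoring G (truncColoring χ₁ P i) := by
  -- A fan edge and a flipped edge.
  have FW : ∀ {x y z : V} {m r : ℕ}, m ≤ j → s(x, y) = s(u, v m) → r < i →
      s(x, z) = s(P.vert r, P.vert (r + 1)) → c m ≠ altColor P.fst P.snd (r + 1) := by
    intro x y z m r hm hy hr hz hc
    obtain rfl := h.fan_color hm (by rw [hc]; exact altColor_eq_or _ _ _)
    have hx : x ∈ s(P.vert r, P.vert (r + 1)) := by rw [← hz]; simp
    have hx' : x ∈ s(u, v m) := by rw [← hy]; simp
    have hr0 : r = 0 := by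
      rcases Sym2.mem_iff.1 hx with rfl | rfl
      · exact h.eq_zero_of_mem_last (by omega) hx'
      · exact absurd (h.eq_zero_of_mem_last (by omega) hx') (by omega)
    subst hr0
    rw [h.color_last] at hc
    exact h.fst_ne_snd (by simpa [altColor] using hc)
  -- A fan edge and an edge that keeps its color.
  have FO : ∀ {x y z : V} {m : ℕ}, m ≤ j → s(x, y) = s(u, v m) →
      (∀ m ≤ j, s(x, z) ≠ s(u, v m)) → (∀ r ≤ i, s(x, z) ≠ s(P.vert r, P.vert (r + 1))) →
      χ s(x, z) ≠ some (c m) := by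
    intro x y z m hm hy hzf hzw hz
    have hx : x ∈ s(u, v m) := by rw [← hy]; simp
    rcases hm.lt_or_eq with hm | rfl
    · rcases Sym2.mem_iff.1 hx with rfl | rfl
      · refine hzf (m + 1) hm ?_
        rw [h.coloring.proper _ _ _ _ hz (h.colored m hm)]
      · exact mem_miss.1 (h.missing m hm) _ hz
    · rw [h.color_last] at hz
      have hx' : x = P.vert 0 ∨ x = o := by
        rw [Sym2.mem_iff] at hx
        rcases h.ends with ⟨h1, h2⟩ | ⟨h1, h2⟩ <;> rw [h1, h2] <;> tauto
      rcases hx' with rfl | rfl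
      · refine hzw 0 (Nat.zero_le _) ?_
        rw [h.coloring.proper _ _ _ _ hz (by simpa [altColor] using h.walk 0 (by omega))]
      · exact mem_miss.1 h.other_miss _ hz
  -- A flipped edge and an edge that keeps its color.
  have WO : ∀ {x y z : V} {r : ℕ}, r < i → s(x, y) = s(P.vert r, P.vert (r + 1)) →
      (∀ r ≤ i, s(x, z) ≠ s(P.vert r, P.vert (r + 1))) →
      χ s(x, z) ≠ some (altColor P.fst P.snd (r + 1)) := by
    intro x y z r hr hy hzw hz
    have hx : x ∈ s(P.vert r, P.vert (r + 1)) := by rw [← hy]; simp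
    rcases Sym2.mem_iff.1 hx with rfl | rfl
    · obtain ⟨r', h1, h2, -⟩ := h.exists_edge (by omega) (altColor_eq_or _ _ _) hz
      exact hzw r' (by omega) h2
    · obtain ⟨r', h1, h2, -⟩ := h.exists_edge (by omega) (altColor_eq_or _ _ _) hz
      exact hzw r' (by omega) h2
  constructor
  · intro e d he
    rcases h.trunc_cases hi he with ⟨m, hm, rfl, -⟩ | ⟨r, hr, rfl, -⟩ | ⟨-, -, h1⟩
    · exact h.adj m hm
    · exact h.coloring.adj (h.walk r (by omega))
    · exact h.coloring.support _ _ h1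
  · intro x y z d hy hz
    rcases h.trunc_cases hi hy with ⟨m, hm, h1, h1'⟩ | ⟨r, hr, h1, h1'⟩ | ⟨h1f, h1w, h1⟩ <;>
    rcases h.trunc_cases hi hz with ⟨m', hm', h2, h2'⟩ | ⟨r', hr', h2, h2'⟩ | ⟨h2f, h2w, h2⟩
    · have hmm : m = m' := by
        have hcc : c m = c m' := h1'.symm.trans h2'
        by_cases hmj : m = j
        · subst hmj
          exact (h.fan_color hm' (Or.inl (by rw [← hcc, h.color_last]))).symm
        · by_cases hmj' : m' = j
          · subst hmj'
            exact h.fan_color hm (Or.inl (by rw [hcc, h.color_last]))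
          · exact h.color_inj m (by omega) m' (by omega) hcc
      subst hmm
      exact Sym2.congr_right.1 (h1.trans h2.symm)
    · exact absurd (h1'.symm.trans h2') (FW hm h1 hr' h2)
    · rw [h1'] at h2
      exact absurd h2 (FO hm h1 h2f h2w)
    · exact absurd (h2'.symm.trans h1') (FW hm' h2 hr h1)
    · have e1 := h.walk r (by omega)
      have e2 := h.walk r' (by omega)
      have hcc : altColor P.fst P.snd r = altColor P.fst P.snd r' := by
        apply (Equiv.swap P.fst P.snd).injective
        rw [swap_altColor, swap_altColor, ← h1', ← h2']
      rw [← h1] at e1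
      rw [← h2, ← hcc] at e2
      exact h.coloring.proper _ _ _ _ e1 e2
    · rw [h1'] at h2
      exact absurd h2 (WO hr h1 h2w)
    · rw [h2'] at h1
      exact absurd h1 (FO hm' h2 h1f h1w)
    · rw [h2'] at h1
      exact absurd h1 (WO hr' h2 h1w)
    · exact h.coloring.proper _ _ _ _ h1 h2

/-- The new end `u'` misses the color of the preceding edge. -/
lemma mem_miss_left (h : IsVizingChain G χ χ₁ u v c j o P N) {i : ℕ} (h0 : 0 < i) (hi : i < N) :
    altColor P.fst P.snd (i + 1) ∈ miss (truncColoring χ₁ P i) (P.vert i) := by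
  rw [mem_miss]
  intro z hz
  rcases h.trunc_cases hi hz with ⟨m, hm, h1, h1'⟩ | ⟨r, hr, h1, h1'⟩ | ⟨h1f, h1w, h1⟩
  · obtain rfl := h.fan_color hm (by rw [← h1']; exact altColor_eq_or _ _ _)
    have := h.eq_zero_of_mem_last hi (by rw [← h1]; simp)
    omega
  · have hx : P.vert i ∈ s(P.vert r, P.vert (r + 1)) := by rw [← h1]; simp
    rcases Sym2.mem_iff.1 hx with h2 | h2
    · have := h.vert_injOn (by omega) (by omega) h2; omega
    · have h3 := h.vert_injOn (by omega) (by omega) h2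
      subst h3
      exact altColor_succ_ne h.fst_ne_snd _ h1'
  · obtain ⟨r, hr, h2, -⟩ := h.exists_edge hi (altColor_eq_or _ _ _) h1
    exact h1w r hr h2

/-- The new end `u'` sees the color of the edge that loses its color. -/
lemma notMem_miss_left (h : IsVizingChain G χ χ₁ u v c j o P N) {i : ℕ} (h0 : 0 < i)
    (hi : i < N) : altColor P.fst P.snd i ∉ miss (truncColoring χ₁ P i) (P.vert i) := by
  obtain ⟨i, rfl⟩ : ∃ r, i = r + 1 := ⟨i - 1, by omega⟩
  intro hm
  refine mem_miss.1 hm (P.vert i) ?_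
  rw [Sym2.eq_swap]
  exact h.trunc_walk hi (Nat.lt_succ_self i)

/-- The new end `v'` misses the color of the edge that loses its color. -/
lemma mem_miss_right (h : IsVizingChain G χ χ₁ u v c j o P N) {i : ℕ} (hi : i + 1 < N) :
    altColor P.fst P.snd i ∈ miss (truncColoring χ₁ P i) (P.vert (i + 1)) := by
  rw [mem_miss]
  intro z hz
  rcases h.trunc_cases (by omega) hz with ⟨m, hm, h1, h1'⟩ | ⟨r, hr, h1, h1'⟩ | ⟨h1f, h1w, h1⟩
  · obtain rfl := h.fan_color hm (by rw [← h1']; exact altColor_eq_or _ _ _)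
    have := h.eq_zero_of_mem_last hi (by rw [← h1]; simp)
    omega
  · have hx : P.vert (i + 1) ∈ s(P.vert r, P.vert (r + 1)) := by rw [← h1]; simp
    rcases Sym2.mem_iff.1 hx with h2 | h2
    · have := h.vert_injOn (by omega) (by omega) h2; omega
    · have := h.vert_injOn (by omega) (by omega) h2; omega
  · obtain ⟨r, hr, h2, h3⟩ := h.exists_edge hi (altColor_eq_or _ _ _) h1
    rcases hr.lt_or_eq with hr | rfl
    · exact h1w r (by omega) h2
    · exact altColor_succ_ne h.fst_ne_snd _ h3.symm

/-- The new end `v'` sees the color of the edge after it. -/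
lemma notMem_miss_right (h : IsVizingChain G χ χ₁ u v c j o P N) {i : ℕ} (hi : i + 1 < N) :
    altColor P.fst P.snd (i + 1) ∉ miss (truncColoring χ₁ P i) (P.vert (i + 1)) := by
  intro hm
  refine mem_miss.1 hm (P.vert (i + 2)) ?_
  rw [h.trunc_eq_of_notMem (fun m hm => h.edge_ne_fan hi hm), h.walk _ hi]
  intro r hr he
  have hx : P.vert (i + 2) ∈ s(P.vert r, P.vert (r + 1)) := by rw [← he]; simp
  rcases Sym2.mem_iff.1 hx with h2 | h2
  · have := h.vert_injOn (by omega) (by omega) h2; omega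
  · have := h.vert_injOn (by omega) (by omega) h2; omega

/-- A truncation affects the colors outside the path only through the fan. -/
lemma trunc_eq_some_iff (h : IsVizingChain G χ χ₁ u v c j o P N) {i : ℕ} (hi : i < N) {e : Sym2 V}
    {d : Fin q} (hd : d ≠ P.fst ∧ d ≠ P.snd) :
    truncColoring χ₁ P i e = some d ↔ χ₁ e = some d := by
  have hflip : flip χ₁ P i e = some d ↔ χ₁ e = some d := by
    unfold flip
    split_ifs
    · rw [Option.map_eq_some_iff]
      constructor
      · rintro ⟨c, hc, hs⟩
        rw [Equiv.swap_apply_eq_iff, Equiv.swap_apply_of_ne_of_ne hd.1 hd.2] at hs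
        rw [hc, hs]
      · intro hc
        exact ⟨d, hc, Equiv.swap_apply_of_ne_of_ne hd.1 hd.2⟩
    · rfl
  by_cases he : e = s(P.vert i, P.vert (i + 1))
  · subst he
    rw [h.shift_walk i hi, truncColoring, Function.update_self]
    constructor
    · intro h; cases h
    · intro h1
      rcases altColor_eq_or P.fst P.snd i with h2 | h2
      · exact absurd ((Option.some.inj h1).symm.trans h2) hd.1
      · exact absurd ((Option.some.inj h1).symm.trans h2) hd.2
  · rw [truncColoring, Function.update_of_ne he, hflip]

end IsVizingChain

end Chain

/-! ### Missing colors and fans -/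

section Fan

variable {V : Type*} {q : ℕ} [Fintype V] {G : SimpleGraph V}

lemma IsPartialColoring.le_card_miss [DecidableRel G.Adj] {χ : Coloring V q}
    (hχ : IsPartialColoring G χ) (x : V) :
    q ≤ (miss χ x).card + G.degree x := by
  classical
  have h1 : ((miss χ x)ᶜ).card ≤ (G.neighborFinset x).card := by
    refine Finset.card_le_card_of_injOn (nbr χ x) ?_ ?_
    · intro c hc
      have hc' : c ∉ miss χ x := by simpa using hc
      simpa using hχ.adj (nbr_spec hc')
    · intro c hc d hd hcd
      have hc' : c ∉ miss χ x := Finset.mem_compl.1 hc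
      have hd' : d ∉ miss χ x := Finset.mem_compl.1 hd
      have h2 := nbr_spec hc'
      rw [hcd, nbr_spec hd'] at h2
      exact (Option.some.inj h2).symm
  rw [Finset.card_compl, Fintype.card_fin, G.card_neighborFinset_eq_degree] at h1
  omega

lemma IsPartialColoring.lt_card_miss [DecidableRel G.Adj] {χ : Coloring V q}
    (hχ : IsPartialColoring G χ) {x y : V} (hxy : G.Adj x y) (hnone : χ s(x, y) = none) :
    q < (miss χ x).card + G.degree x := by
  classical
  have h1 : ((miss χ x)ᶜ).card ≤ ((G.neighborFinset x).erase y).card := by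
    refine Finset.card_le_card_of_injOn (nbr χ x) ?_ ?_
    · intro c hc
      have hc' : c ∉ miss χ x := by simpa using hc
      have h2 := nbr_spec hc'
      rw [Finset.coe_erase]
      refine ⟨by simpa using hχ.adj h2, fun h3 => ?_⟩
      rw [Set.mem_singleton_iff.1 h3, hnone] at h2
      cases h2
    · intro c hc d hd hcd
      have hc' : c ∉ miss χ x := Finset.mem_compl.1 hc
      have hd' : d ∉ miss χ x := Finset.mem_compl.1 hd
      have h2 := nbr_spec hc'
      rw [hcd, nbr_spec hd'] at h2
      exact (Option.some.inj h2).symm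
  have h2 : 0 < G.degree x := (G.degree_pos_iff_exists_adj x).2 ⟨y, hxy⟩
  rw [Finset.card_compl, Fintype.card_fin, Finset.card_erase_of_mem (by simpa using hxy),
    G.card_neighborFinset_eq_degree] at h1
  omega

/-- What holds at the start of every iteration. -/
structure State.IsValid (G : SimpleGraph V) (s : State V q) : Prop where
  coloring : IsPartialColoring G s.χ
  adj : G.Adj s.u s.v
  uncolored : s.χ s(s.u, s.v) = none
  cu_mem : s.cu ∈ miss s.χ s.u
  cv_mem : s.cv ∈ miss s.χ s.v

/-- The choices made by `pick` are legal. -/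
def IsChoice (pick : Choice q) : Prop := ∀ p S, S.Nonempty → pick p S ∈ S

variable {pick : Choice q} {s : State V q}

lemma State.IsValid.miss_sdiff_nonempty [DecidableRel G.Adj] (hs : s.IsValid G)
    (hq : G.maxDegree < q)
    {x y : V} (hxy : G.Adj x y) (hnone : s.χ s(x, y) = none) (c : Fin q) :
    (miss s.χ x \ {c}).Nonempty := by
  rw [← Finset.card_pos]
  have h1 := hs.coloring.lt_card_miss hxy hnone
  have h2 := G.degree_le_maxDegree x
  have h3 := Finset.le_card_sdiff {c} (miss s.χ x)
  rw [Finset.card_singleton] at h3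
  omega

lemma State.IsValid.miss_nonempty [DecidableRel G.Adj] (hs : s.IsValid G)
    (hq : G.maxDegree < q) (x : V) :
    (miss s.χ x).Nonempty := by
  rw [← Finset.card_pos]
  have h1 := hs.coloring.le_card_miss x
  have h2 := G.degree_le_maxDegree x
  omega

lemma fanC_mem_miss [DecidableRel G.Adj] (hs : s.IsValid G) (hq : G.maxDegree < q)
    (hpick : IsChoice pick) (i : ℕ) :
    fanC pick s i ∈ miss s.χ (fanV pick s i) := by
  cases i with
  | zero =>
    have h := hpick (.fan 0) _ (hs.miss_sdiff_nonempty hq hs.adj.symm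
      (by rw [Sym2.eq_swap]; exact hs.uncolored) s.cv)
    exact (Finset.mem_sdiff.1 h).1
  | succ i =>
    change (fan pick s (i + 1)).2 ∈ miss s.χ (fan pick s (i + 1)).1
    rw [fan]
    dsimp only
    split_ifs with h
    · exact h
    · exact hpick _ _ (hs.miss_nonempty hq _)

lemma fanC_zero_ne [DecidableRel G.Adj] (hs : s.IsValid G) (hq : G.maxDegree < q)
    (hpick : IsChoice pick) :
    fanC pick s 0 ≠ s.cv := by
  have h := hpick (.fan 0) _ (hs.miss_sdiff_nonempty hq hs.adj.symm
    (by rw [Sym2.eq_swap]; exact hs.uncolored) s.cv)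
  have h2 := (Finset.mem_sdiff.1 h).2
  rwa [Finset.mem_singleton] at h2

lemma fanLast_spec (pick : Choice q) (s : State V q) :
    (∃ j < fanLast pick s, fanC pick s j = fanC pick s (fanLast pick s)) ∨
      fanC pick s (fanLast pick s) ∈ miss s.χ s.u := by
  have h : {i | (∃ j < i, fanC pick s j = fanC pick s i) ∨
      fanC pick s i ∈ miss s.χ s.u}.Nonempty := by
    obtain ⟨i, j, hij, he⟩ := Finite.exists_ne_map_eq_of_infinite (fanC pick s)
    rcases lt_or_gt_of_ne hij with h | h
    · exact ⟨j, Or.inl ⟨i, h, he⟩⟩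
    · exact ⟨i, Or.inl ⟨j, h, he.symm⟩⟩
  exact Nat.sInf_mem h

lemma fanC_notMem_miss (hE : ¬ FanExtends pick s) {i : ℕ} (hi : i ≤ fanLast pick s) :
    fanC pick s i ∉ miss s.χ s.u := by
  rcases hi.lt_or_eq with hi | rfl
  · exact fun h => Nat.notMem_of_lt_sInf hi (Or.inr h)
  · exact hE

lemma fanC_inj {i j : ℕ} (hi : i < fanLast pick s) (hj : j < fanLast pick s)
    (h : fanC pick s i = fanC pick s j) : i = j := by
  rcases lt_trichotomy i j with hij | hij | hij
  · exact absurd (Or.inl ⟨i, hij, h⟩) (Nat.notMem_of_lt_sInf hj)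
  · exact hij
  · exact absurd (Or.inl ⟨j, hij, h.symm⟩) (Nat.notMem_of_lt_sInf hi)

lemma pivot_spec (pick : Choice q) (s : State V q) :
    fanC pick s (pivot pick s) = fanC pick s (fanLast pick s) :=
  Nat.sInf_mem (s := {j | fanC pick s j = fanC pick s (fanLast pick s)}) ⟨_, rfl⟩

lemma pivot_lt (hE : ¬ FanExtends pick s) : pivot pick s < fanLast pick s := by
  obtain ⟨j, hj, he⟩ := (fanLast_spec pick s).resolve_right hE
  exact lt_of_le_of_lt (Nat.sInf_le he) hj

lemma fanC_ne_last {i : ℕ} (hi : i < pivot pick s) :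
    fanC pick s i ≠ fanC pick s (fanLast pick s) :=
  fun h => Nat.notMem_of_lt_sInf hi h

/-- The edge to the next vertex of the fan has the current color; this color is seen at the
center, so `nbr` is not a default value. -/
lemma color_fan_succ (hE : ¬ FanExtends pick s) {i : ℕ} (hi : i ≤ fanLast pick s) :
    s.χ s(s.u, fanV pick s (i + 1)) = some (fanC pick s i) :=
  nbr_spec (fanC_notMem_miss hE hi)

lemma fanV_adj (hs : s.IsValid G) (hE : ¬ FanExtends pick s) {i : ℕ} (hi : i ≤ fanLast pick s) :
    G.Adj s.u (fanV pick s i) := by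
  cases i with
  | zero => exact hs.adj
  | succ i => exact hs.coloring.adj (color_fan_succ hE (by omega))

lemma fanV_inj (hs : s.IsValid G) (hE : ¬ FanExtends pick s) {i j : ℕ} (hi : i ≤ fanLast pick s)
    (hj : j ≤ fanLast pick s) (h : fanV pick s i = fanV pick s j) : i = j := by
  have h0 : ∀ {i}, i + 1 ≤ fanLast pick s → fanV pick s (i + 1) ≠ fanV pick s 0 := by
    intro i hi h
    have h1 := color_fan_succ hE (show i ≤ fanLast pick s by omega)
    rw [h] at h1
    have h2 : s.χ s(s.u, fanV pick s 0) = none := hs.uncolored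
    rw [h2] at h1
    cases h1
  cases i with
  | zero =>
    cases j with
    | zero => rfl
    | succ j => exact absurd h.symm (h0 hj)
  | succ i =>
    cases j with
    | zero => exact absurd h (h0 hi)
    | succ j =>
      have h1 := color_fan_succ hE (show i ≤ fanLast pick s by omega)
      rw [h, color_fan_succ hE (by omega)] at h1
      rw [fanC_inj (by omega) (by omega) (Option.some.inj h1).symm]

lemma vizingPath_isAltWalk (pick : Choice q) (s : State V q) :
    IsAltWalk s.χ (vizingPath pick s).vert (vizingPath pick s).fst (vizingPath pick s).snd
      (vizingPath pick s).length := by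
  unfold vizingPath
  split_ifs <;> exact altPath_isAltWalk _ _ _ _

lemma vizingPath_of_primed (h : Primed pick s) :
    (vizingPath pick s).fst = s.cu ∧ (vizingPath pick s).snd = s.cv ∧
      (vizingPath pick s).vert 0 = fanV pick s (pivot pick s) := by
  rw [vizingPath, if_pos h]
  exact ⟨rfl, rfl, rfl⟩

lemma vizingPath_of_not_primed (h : ¬ Primed pick s) :
    (vizingPath pick s).fst = fanC pick s (fanLast pick s) ∧
      (vizingPath pick s).snd = pick .path (miss s.χ s.u \ {s.cu}) ∧
      (vizingPath pick s).vert 0 = s.u := by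
  rw [vizingPath, if_neg h]
  exact ⟨rfl, rfl, rfl⟩

lemma snd_mem [DecidableRel G.Adj] (hs : s.IsValid G) (hq : G.maxDegree < q) (hpick : IsChoice pick)
    (h : ¬ Primed pick s) :
    (vizingPath pick s).snd ∈ miss s.χ s.u ∧ (vizingPath pick s).snd ≠ s.cu := by
  rw [(vizingPath_of_not_primed h).2.1]
  have := hpick .path _ (hs.miss_sdiff_nonempty hq hs.adj hs.uncolored s.cu)
  rwa [Finset.mem_sdiff, Finset.mem_singleton] at this

variable [DecidableEq V]

lemma shiftFan_fan (hs : s.IsValid G) (hE : ¬ FanExtends pick s) {M m : ℕ}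
    (hM : M ≤ fanLast pick s + 1) (hm : m < M) :
    shiftFan pick s M s(s.u, fanV pick s m) = some (fanC pick s m) := by
  induction M with
  | zero => omega
  | succ M ih =>
    rw [shiftFan]
    by_cases h : m = M
    · subst h; simp
    · rw [Function.update_of_ne, ih (by omega) (by omega)]
      intro he
      exact h (fanV_inj hs hE (by omega) (by omega) (Sym2.congr_right.1 he))

lemma shiftFan_other {M : ℕ} {e : Sym2 V} (h : ∀ m < M, e ≠ s(s.u, fanV pick s m)) :
    shiftFan pick s M e = s.χ e := by
  induction M with
  | zero => rfl
  | succ M ih =>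
    rw [shiftFan, Function.update_of_ne (h M (Nat.lt_succ_self M)), ih fun m hm => h m (by omega)]

/-! ### One iteration -/

open Classical in
/-- The coloring with shifted fan from which a truncation starts. -/
noncomputable def preflip (pick : Choice q) (s : State V q) : Coloring V q :=
  if Primed pick s then
    Function.update (shiftFan pick s (pivot pick s)) s(s.u, fanV pick s (pivot pick s)) (some s.cu)
  else
    shiftFan pick s (pivot pick s + 1)

open Classical in
/-- The colors that the fan edges receive before a truncation. -/
noncomputable def preflipColor (pick : Choice q) (s : State V q) (m : ℕ) : Fin q :=
  if m < pivot pick s then fanC pick s m else (vizingPath pick s).fst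

/-- The objects of an iteration that does not extend the coloring at once form a Vizing chain. -/
lemma exists_isVizingChain [DecidableRel G.Adj] (hs : s.IsValid G) (hq : G.maxDegree < q)
    (hpick : IsChoice pick)
    (hE : ¬ FanExtends pick s) :
    ∃ o, IsVizingChain G s.χ (preflip pick s) s.u (fanV pick s) (preflipColor pick s)
      (pivot pick s) o (vizingPath pick s) (vizingPath pick s).length := by
  classical
  have hlt := pivot_lt hE
  have hlast : fanC pick s (fanLast pick s) ∉ miss s.χ s.u := hE
  refine ⟨if Primed pick s then s.u else fanV pick s (pivot pick s), ?_⟩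
  refine
    { coloring := hs.coloring
      adj := fun m hm => fanV_adj hs hE (by omega)
      vert_inj := fun m hm m' hm' h => fanV_inj hs hE (by omega) (by omega) h
      uncolored := hs.uncolored
      colored := ?_
      missing := ?_
      color_inj := ?_
      color_ne := ?_
      color_last := by simp [preflipColor]
      fst_ne_snd := ?_
      walk := vizingPath_isAltWalk pick s
      start_miss := ?_
      ends := ?_
      other_miss := ?_
      shift_fan := ?_
      shift_other := ?_ }
  · intro m hm
    rw [preflipColor, if_pos hm]
    exact color_fan_succ hE (by omega)
  · intro m hm
    rw [preflipColor, if_pos hm]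
    exact fanC_mem_miss hs hq hpick m
  · intro m hm m' hm'
    rw [preflipColor, if_pos hm, preflipColor, if_pos hm']
    exact fanC_inj (by omega) (by omega)
  · intro m hm
    rw [preflipColor, if_pos hm]
    have h1 := fanC_notMem_miss hE (show m ≤ fanLast pick s by omega)
    have h2 := fanC_ne_last hm
    by_cases hp : Primed pick s
    · obtain ⟨h3, h4, -⟩ := vizingPath_of_primed hp
      rw [h3, h4]
      refine ⟨fun h => h1 (h ▸ hs.cu_mem), ?_⟩
      exact fun h => h2 (h.trans (show fanC pick s (fanLast pick s) = s.cv from hp).symm)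
    · obtain ⟨h3, -, -⟩ := vizingPath_of_not_primed hp
      rw [h3]
      exact ⟨h2, fun h => h1 (h ▸ (snd_mem hs hq hpick hp).1)⟩
  · by_cases hp : Primed pick s
    · obtain ⟨h3, h4, -⟩ := vizingPath_of_primed hp
      have hp' : fanC pick s (fanLast pick s) = s.cv := hp
      rw [h3, h4, ← hp']
      exact fun h => hlast (h ▸ hs.cu_mem)
    · rw [(vizingPath_of_not_primed hp).1]
      exact fun h => hlast (h ▸ (snd_mem hs hq hpick hp).1)
  · by_cases hp : Primed pick s
    · obtain ⟨-, h4, h5⟩ := vizingPath_of_primed hp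
      have hp' : fanC pick s (fanLast pick s) = s.cv := hp
      rw [h4, h5, ← hp', ← pivot_spec]
      exact fanC_mem_miss hs hq hpick _
    · rw [(vizingPath_of_not_primed hp).2.2]
      exact (snd_mem hs hq hpick hp).1
  · by_cases hp : Primed pick s
    · rw [if_pos hp]
      exact Or.inr ⟨(vizingPath_of_primed hp).2.2, rfl⟩
    · rw [if_neg hp]
      exact Or.inl ⟨(vizingPath_of_not_primed hp).2.2, rfl⟩
  · by_cases hp : Primed pick s
    · rw [if_pos hp, (vizingPath_of_primed hp).1]
      exact hs.cu_mem
    · rw [if_neg hp, (vizingPath_of_not_primed hp).1, ← pivot_spec]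
      exact fanC_mem_miss hs hq hpick _
  · intro m hm
    by_cases hp : Primed pick s
    · rw [preflip, if_pos hp]
      rcases hm.lt_or_eq with hm | rfl
      · rw [Function.update_of_ne, shiftFan_fan hs hE (by omega) hm, preflipColor, if_pos hm]
        intro he
        have := fanV_inj hs hE (by omega) (by omega) (Sym2.congr_right.1 he)
        omega
      · rw [Function.update_self, preflipColor, if_neg (lt_irrefl _), (vizingPath_of_primed hp).1]
    · rw [preflip, if_neg hp, shiftFan_fan hs hE (by omega) (by omega), preflipColor]
      split_ifs with h
      · rfl
      · obtain rfl : m = pivot pick s := by omega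
        rw [pivot_spec, (vizingPath_of_not_primed hp).1]
  · intro e he
    by_cases hp : Primed pick s
    · rw [preflip, if_pos hp, Function.update_of_ne (he _ le_rfl),
        shiftFan_other fun m hm => he m hm.le]
    · rw [preflip, if_neg hp, shiftFan_other fun m hm => he m (by omega)]

/-- An iteration that does not return truncates a long path. -/
lemma iteration_eq_inl {L i : ℕ} (hi : i ≤ L) {s' : State V q}
    (h : iteration pick s L i = .inl s') :
    ¬ FanExtends pick s ∧ 2 * L + 2 < (vizingPath pick s).length ∧
      s'.χ = truncColoring (preflip pick s) (vizingPath pick s) i ∧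
      s'.u = (vizingPath pick s).vert i ∧ s'.v = (vizingPath pick s).vert (i + 1) ∧
      s'.cu = pick .endU (miss s'.χ s'.u ∩ {(vizingPath pick s).fst, (vizingPath pick s).snd}) ∧
      s'.cv = pick .endV (miss s'.χ s'.v ∩ {(vizingPath pick s).fst, (vizingPath pick s).snd}) := by
  unfold iteration at h
  split_ifs at h with h1
  push Not at h1
  unfold truncatedVizing at h
  rw [if_neg (by push Not; exact ⟨h1.1, by omega⟩)] at h
  have h2 := Sum.inl.inj h
  subst h2
  exact ⟨h1.1, h1.2, rfl, rfl, rfl, rfl, rfl⟩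

/-- After a truncation of the path `P` the state is valid again, its colors `cu` and `cv` are those
of `P`, and `cv` is not missing at `u`. -/
lemma iteration_valid [DecidableRel G.Adj] (hs : s.IsValid G) (hq : G.maxDegree < q)
    (hpick : IsChoice pick) {L i : ℕ}
    (h0 : 0 < i) (hi : i ≤ L) {s' : State V q} (h : iteration pick s L i = .inl s') :
    s'.IsValid G ∧ s'.cv ∉ miss s'.χ s'.u ∧
      ((s'.cu = (vizingPath pick s).fst ∧ s'.cv = (vizingPath pick s).snd) ∨
        (s'.cu = (vizingPath pick s).snd ∧ s'.cv = (vizingPath pick s).fst)) := by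
  obtain ⟨hE, hlen, hχ, hu, hv, hcu, hcv⟩ := iteration_eq_inl hi h
  obtain ⟨o, hc⟩ := exists_isVizingChain hs hq hpick hE
  set P := vizingPath pick s
  have hl := hc.mem_miss_left h0 (by omega)
  have hl' := hc.notMem_miss_left h0 (by omega)
  have hr := hc.mem_miss_right (i := i) (by omega)
  have hr' := hc.notMem_miss_right (i := i) (by omega)
  rw [← hχ, ← hu] at hl hl'
  rw [← hχ, ← hv] at hr hr'
  have mem_pair : ∀ r, altColor P.fst P.snd r ∈ ({P.fst, P.snd} : Finset (Fin q)) := by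
    intro r
    simpa using altColor_eq_or P.fst P.snd r
  have hcu' : s'.cu ∈ miss s'.χ s'.u ∩ {P.fst, P.snd} := by
    rw [hcu]
    exact hpick _ _ ⟨_, Finset.mem_inter.2 ⟨hl, mem_pair _⟩⟩
  have hcv' : s'.cv ∈ miss s'.χ s'.v ∩ {P.fst, P.snd} := by
    rw [hcv]
    exact hpick _ _ ⟨_, Finset.mem_inter.2 ⟨hr, mem_pair _⟩⟩
  rw [Finset.mem_inter, Finset.mem_insert, Finset.mem_singleton] at hcu' hcv'
  have ecu : s'.cu = altColor P.fst P.snd (i + 1) :=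
    (altColor_eq_or_succ _ _ hcu'.2 i).resolve_left fun h => hl' (h ▸ hcu'.1)
  have ecv : s'.cv = altColor P.fst P.snd i :=
    (altColor_eq_or_succ _ _ hcv'.2 i).resolve_right fun h => hr' (h ▸ hcv'.1)
  refine ⟨⟨?_, ?_, ?_, hcu'.1, hcv'.1⟩, by rw [ecv]; exact hl', ?_⟩
  · rw [hχ]
    exact hc.isPartialColoring_trunc h0 (by omega)
  · rw [hu, hv]
    exact hs.coloring.adj (hc.walk i (by omega))
  · rw [hχ, hu, hv]
    simp [truncColoring]
  · rw [ecu, ecv]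
    by_cases hev : Even i <;> simp [altColor, hev, Nat.even_add_one]

end Fan

/-! ### Counting ends of long paths -/

section Counting

/-- In a graph of maximum degree at most two, every vertex lies on few long paths that start at an
end of a component, so that there are few such paths. -/
lemma card_mul_le_of_paths {V ι : Type*} [Fintype V] {H : V → V → Prop}
    (hsymm : ∀ x y, H x y → H y x)
    (hdeg : ∀ x y₁ y₂ y₃, H x y₁ → H x y₂ → H x y₃ → y₁ = y₂ ∨ y₁ = y₃ ∨ y₂ = y₃)
    (T : Finset ι) (M : ℕ) (f : ι → ℕ → V) (hf0 : ∀ i ∈ T, ∀ j ∈ T, f i 0 = f j 0 → i = j)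
    (hinj : ∀ i ∈ T, ∀ r ≤ M, ∀ r' ≤ M, f i r = f i r' → r = r')
    (hH : ∀ i ∈ T, ∀ r < M, H (f i r) (f i (r + 1)))
    (hend : ∀ i ∈ T, ∀ y z, H (f i 0) y → H (f i 0) z → y = z) :
    T.card * M ≤ 2 * Fintype.card V := by
  classical
  -- No path enters the first vertex of another path along the reverse of its first edge.
  have start : ∀ i ∈ T, ∀ j ∈ T, ∀ r', r' + 1 < M → 0 < M → f i 0 = f j (r' + 1) →
      f i 1 ≠ f j (r' + 1 + 1) := by
    intro i hi j hj r' hr' hM h0 h1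
    have e1 := hH i hi 0 hM
    have e2 := hsymm _ _ (hH j hj r' (by omega))
    rw [← h0] at e2
    have e3 := hend i hi _ _ e1 e2
    rw [h1] at e3
    have := hinj j hj _ (by omega) _ (by omega) e3
    omega
  have key : ∀ i ∈ T, ∀ j ∈ T, ∀ r r', r < M → r' < M → f i r = f j r' →
      f i (r + 1) = f j (r' + 1) → i = j ∧ r = r' := by
    intro i hi j hj r
    induction r with
    | zero =>
      intro r' hr hr' h0 h1
      cases r' with
      | zero => exact ⟨hf0 i hi j hj h0, rfl⟩
      | succ r' => exact absurd h1 (start i hi j hj r' hr' hr h0)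
    | succ r ih =>
      intro r' hr hr' h0 h1
      cases r' with
      | zero => exact absurd h1.symm (start j hj i hi r hr hr' h0.symm)
      | succ r' =>
        have e1 := hsymm _ _ (hH i hi r (by omega))
        have e2 := hH i hi (r + 1) hr
        have e3 := hsymm _ _ (hH j hj r' (by omega))
        rw [← h0] at e3
        rcases hdeg _ _ _ _ e1 e2 e3 with h | h | h
        · have := hinj i hi _ (by omega) _ (by omega) h
          omega
        · have := ih r' (by omega) (by omega) h h0
          exact ⟨this.1, by omega⟩
        · rw [h1] at h
          have := hinj j hj _ (by omega) _ (by omega) h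
          omega
  have h1 : (T ×ˢ Finset.range M).card ≤
      (Finset.univ.filter fun p : V × V => H p.1 p.2).card := by
    refine Finset.card_le_card_of_injOn (fun p => (f p.1 p.2, f p.1 (p.2 + 1))) ?_ ?_
    · rintro ⟨i, r⟩ h
      simp only [Finset.coe_product, Set.mem_prod, Finset.mem_coe, Finset.mem_range] at h
      simpa using hH i h.1 r h.2
    · rintro ⟨i, r⟩ h ⟨j, r'⟩ h' he
      simp only [Finset.coe_product, Set.mem_prod, Finset.mem_coe, Finset.mem_range] at h h'
      simp only [Prod.mk.injEq] at he
      have := key i h.1 j h'.1 r r' h.2 h'.2 he.1 he.2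
      rw [this.1, this.2]
  have h2 : (Finset.univ.filter fun p : V × V => H p.1 p.2).card ≤ 2 * Fintype.card V := by
    rw [Finset.card_filter, ← Finset.univ_product_univ, Finset.sum_product, mul_comm,
      ← smul_eq_mul, ← Finset.card_univ]
    refine Finset.sum_le_card_nsmul _ _ _ fun x _ => ?_
    rw [← Finset.card_filter]
    by_contra hlt
    obtain ⟨y₁, g1, y₂, g2, y₃, g3, n1, n2, n3⟩ := Finset.two_lt_card.1 (not_le.1 hlt)
    simp only [Finset.mem_filter, Finset.mem_univ, true_and] at g1 g2 g3
    rcases hdeg x y₁ y₂ y₃ g1 g2 g3 with h | h | h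
    · exact n1 h
    · exact n2 h
    · exact n3 h
  rw [Finset.card_product, Finset.card_range] at h1
  exact h1.trans h2

end Counting

/-! ### Unfavorable samples of one iteration -/

section OneStep

variable {V : Type*} {q : ℕ} [Fintype V] [DecidableEq V]

/-- The iteration does not return a coloring. -/
def IsLong (L : ℕ) (pick : Choice q) (s : State V q) : Prop :=
  ¬ FanExtends pick s ∧ 2 * L + 2 < (vizingPath pick s).length

/-- All truncations of one iteration: `nx t` is the state which arises from `s` by the sample
`t + 1`, and `pk t` are the choices made in the following iteration. -/
structure IsStep (G : SimpleGraph V) (L : ℕ) (pick : Choice q) (s : State V q)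
    (pk : Fin L → Choice q) (nx : Fin L → State V q) : Prop where
  valid : s.IsValid G
  choice : IsChoice pick
  choice_next : ∀ t, IsChoice (pk t)
  next : ∀ t : Fin L, iteration pick s L (t + 1) = .inl (nx t)

namespace IsStep

variable {G : SimpleGraph V} {L : ℕ} {pick : Choice q} {s : State V q}
  {pk : Fin L → Choice q} {nx : Fin L → State V q}

lemma next_u (h : IsStep G L pick s pk nx) (t : Fin L) :
    (nx t).u = (vizingPath pick s).vert (t + 1) :=
  (iteration_eq_inl (by omega) (h.next t)).2.2.2.1

lemma next_v (h : IsStep G L pick s pk nx) (t : Fin L) :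
    (nx t).v = (vizingPath pick s).vert (t + 1 + 1) :=
  (iteration_eq_inl (by omega) (h.next t)).2.2.2.2.1

lemma next_χ (h : IsStep G L pick s pk nx) (t : Fin L) :
    (nx t).χ = truncColoring (preflip pick s) (vizingPath pick s) (t + 1) :=
  (iteration_eq_inl (by omega) (h.next t)).2.2.1

lemma length_gt (h : IsStep G L pick s pk nx) (t : Fin L) :
    2 * L + 2 < (vizingPath pick s).length :=
  (iteration_eq_inl (by omega) (h.next t)).2.1

variable [DecidableRel G.Adj]

lemma next_valid (h : IsStep G L pick s pk nx) (hq : G.maxDegree < q) (t : Fin L) :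
    (nx t).IsValid G ∧ (nx t).cv ∉ miss (nx t).χ (nx t).u ∧
      (((nx t).cu = (vizingPath pick s).fst ∧ (nx t).cv = (vizingPath pick s).snd) ∨
        ((nx t).cu = (vizingPath pick s).snd ∧ (nx t).cv = (vizingPath pick s).fst)) :=
  iteration_valid h.valid hq h.choice (Nat.succ_pos _) (by omega) (h.next t)

lemma exists_chain (h : IsStep G L pick s pk nx) (hq : G.maxDegree < q) (t : Fin L) :
    ∃ o, IsVizingChain G s.χ (preflip pick s) s.u (fanV pick s) (preflipColor pick s)
      (pivot pick s) o (vizingPath pick s) (vizingPath pick s).length :=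
  exists_isVizingChain h.valid hq h.choice (iteration_eq_inl (by omega) (h.next t)).1

lemma next_u_inj (h : IsStep G L pick s pk nx) (hq : G.maxDegree < q) {t t' : Fin L}
    (he : (nx t).u = (nx t').u) : t = t' := by
  obtain ⟨o, hc⟩ := h.exists_chain hq t
  have hl := h.length_gt t
  rw [h.next_u, h.next_u] at he
  have := hc.vert_injOn (by omega) (by omega) he
  exact Fin.ext (by omega)

/-- The states after different truncations agree on the colors outside the truncated path. -/
lemma next_χ_iff (h : IsStep G L pick s pk nx) (hq : G.maxDegree < q) (t t' : Fin L) {e : Sym2 V}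
    {d : Fin q} (hd : d ≠ (vizingPath pick s).fst ∧ d ≠ (vizingPath pick s).snd) :
    (nx t).χ e = some d ↔ (nx t').χ e = some d := by
  obtain ⟨o, hc⟩ := h.exists_chain hq t
  have hl := h.length_gt t
  rw [h.next_χ, h.next_χ, hc.trunc_eq_some_iff (by omega) hd, hc.trunc_eq_some_iff (by omega) hd]

/-- The states before and after a truncation agree on the colors outside the path, except near the
center of the fan. -/
lemma next_χ_iff_self (h : IsStep G L pick s pk nx) (hq : G.maxDegree < q) (t : Fin L) {e : Sym2 V}
    {d : Fin q} (hd : d ≠ (vizingPath pick s).fst ∧ d ≠ (vizingPath pick s).snd)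
    (he : s.u ∉ e) : (nx t).χ e = some d ↔ s.χ e = some d := by
  obtain ⟨o, hc⟩ := h.exists_chain hq t
  have hl := h.length_gt t
  rw [h.next_χ, hc.trunc_eq_some_iff (by omega) hd, hc.shift_other]
  rintro m - rfl
  exact he (by simp)

/-- Unless it is primed, the next path avoids the colors of the truncated one. -/
lemma next_colors (h : IsStep G L pick s pk nx) (hq : G.maxDegree < q) (t : Fin L)
    (hlong : IsLong L (pk t) (nx t)) (hp : ¬ Primed (pk t) (nx t)) :
    ((vizingPath (pk t) (nx t)).fst ≠ (vizingPath pick s).fst ∧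
      (vizingPath (pk t) (nx t)).fst ≠ (vizingPath pick s).snd) ∧
    ((vizingPath (pk t) (nx t)).snd ≠ (vizingPath pick s).fst ∧
      (vizingPath (pk t) (nx t)).snd ≠ (vizingPath pick s).snd) := by
  obtain ⟨hv, hcv, hc⟩ := h.next_valid hq t
  obtain ⟨h1, h2⟩ := snd_mem hv hq (h.choice_next t) hp
  have h3 : (vizingPath (pk t) (nx t)).fst ≠ (nx t).cv := by
    rw [(vizingPath_of_not_primed hp).1]; exact hp
  have h4 : (vizingPath (pk t) (nx t)).fst ≠ (nx t).cu := by
    rw [(vizingPath_of_not_primed hp).1]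
    intro he
    refine hlong.1 ?_
    rw [FanExtends, he]
    exact hv.cu_mem
  have h5 : (vizingPath (pk t) (nx t)).snd ≠ (nx t).cv := fun h => hcv (h ▸ h1)
  rcases hc with ⟨e1, e2⟩ | ⟨e1, e2⟩ <;> rw [← e1, ← e2] <;> tauto

/-- Unless it is primed, the next path can be read off from the coloring after any other
truncation. -/
lemma next_walk (h : IsStep G L pick s pk nx) (hq : G.maxDegree < q) (t t' : Fin L)
    (hlong : IsLong L (pk t) (nx t)) (hp : ¬ Primed (pk t) (nx t)) :
    IsAltWalk (nx t').χ (vizingPath (pk t) (nx t)).vert (vizingPath (pk t) (nx t)).fst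
      (vizingPath (pk t) (nx t)).snd (vizingPath (pk t) (nx t)).length ∧
    (vizingPath (pk t) (nx t)).snd ∈ miss (nx t').χ ((vizingPath (pk t) (nx t)).vert 0) := by
  obtain ⟨h1, h2⟩ := h.next_colors hq t hlong hp
  constructor
  · intro r hr
    rw [h.next_χ_iff hq t' t]
    · exact vizingPath_isAltWalk _ _ r hr
    · rcases altColor_eq_or (vizingPath (pk t) (nx t)).fst (vizingPath (pk t) (nx t)).snd r
        with h3 | h3 <;> rw [h3] <;> assumption
  · rw [(vizingPath_of_not_primed hp).2.2, mem_miss]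
    intro w hw
    rw [h.next_χ_iff hq t' t h2] at hw
    exact mem_miss.1 (snd_mem (h.next_valid hq t).1 hq (h.choice_next t) hp).1 w hw

open Classical in
/-- There are few samples after which the next path is long and has a given pair of colors. -/
lemma card_colors_mul_le (h : IsStep G L pick s pk nx) (hq : G.maxDegree < q) (a b : Fin q) :
    (Finset.univ.filter fun t : Fin L => IsLong L (pk t) (nx t) ∧ ¬ Primed (pk t) (nx t) ∧
      (vizingPath (pk t) (nx t)).fst = a ∧ (vizingPath (pk t) (nx t)).snd = b).card * (2 * L + 2) ≤
      2 * Fintype.card V := by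
  set T := Finset.univ.filter fun t : Fin L => IsLong L (pk t) (nx t) ∧ ¬ Primed (pk t) (nx t) ∧
      (vizingPath (pk t) (nx t)).fst = a ∧ (vizingPath (pk t) (nx t)).snd = b with hT
  rcases T.eq_empty_or_nonempty with h0 | ⟨t₀, -⟩
  · simp [h0]
  have hcol := (h.next_valid hq t₀).1.coloring
  have hmem : ∀ t ∈ T, IsLong L (pk t) (nx t) ∧ ¬ Primed (pk t) (nx t) ∧
      (vizingPath (pk t) (nx t)).fst = a ∧ (vizingPath (pk t) (nx t)).snd = b := by
    intro t ht
    simpa [hT] using ht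
  have hwalk : ∀ t ∈ T, IsAltWalk (nx t₀).χ (vizingPath (pk t) (nx t)).vert a b (2 * L + 2) ∧
      b ∈ miss (nx t₀).χ ((vizingPath (pk t) (nx t)).vert 0) := by
    intro t ht
    obtain ⟨h1, h2, h3, h4⟩ := hmem t ht
    have h5 := h.next_walk hq t t₀ h1 h2
    rw [h3, h4] at h5
    exact ⟨h5.1.mono h1.2.le, h5.2⟩
  refine card_mul_le_of_paths (H := fun x y => (nx t₀).χ s(x, y) = some a ∨
    (nx t₀).χ s(x, y) = some b) ?_ ?_ T (2 * L + 2) (fun t => (vizingPath (pk t) (nx t)).vert)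
    ?_ ?_ ?_ ?_
  · intro x y hxy
    rwa [Sym2.eq_swap]
  · intro x y₁ y₂ y₃ h1 h2 h3
    have := hcol.proper x
    rcases h1 with h1 | h1 <;> rcases h2 with h2 | h2 <;> rcases h3 with h3 | h3
    all_goals first
      | exact Or.inl (this _ _ _ h1 h2)
      | exact Or.inr (Or.inl (this _ _ _ h1 h3))
      | exact Or.inr (Or.inr (this _ _ _ h2 h3))
  · intro t ht t' ht' he
    rw [(vizingPath_of_not_primed (hmem t ht).2.1).2.2,
      (vizingPath_of_not_primed (hmem t' ht').2.1).2.2] at he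
    exact h.next_u_inj hq he
  · intro t ht r hr r' hr' he
    exact (hwalk t ht).1.injOn hcol (hwalk t ht).2 hr hr' he
  · intro t ht r hr
    have := (hwalk t ht).1 r hr
    rcases altColor_eq_or a b r with h3 | h3 <;> rw [h3] at this <;> tauto
  · intro t ht y z hy hz
    have hm := mem_miss.1 (hwalk t ht).2
    exact hcol.proper _ _ _ _ (hy.resolve_right (hm y)) (hz.resolve_right (hm z))

open Classical in
/-- There are few samples after which the next path is long and primed. -/
lemma card_primed_mul_le (h : IsStep G L pick s pk nx) (hq : G.maxDegree < q) (hL : 3 ≤ L) :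
    (Finset.univ.filter fun t : Fin L => IsLong L (pk t) (nx t) ∧ Primed (pk t) (nx t)).card *
      (2 * L + 2) ≤ G.maxDegree * (2 * Fintype.card V) := by
  set T := Finset.univ.filter fun t : Fin L => IsLong L (pk t) (nx t) ∧ Primed (pk t) (nx t) with hT
  have hmem : ∀ t ∈ T, IsLong L (pk t) (nx t) ∧ Primed (pk t) (nx t) := by
    intro t ht
    simpa [hT] using ht
  set P := vizingPath pick s with hP
  set w : Fin L → V := fun t => (vizingPath (pk t) (nx t)).vert 0 with hw
  have hwv : ∀ t ∈ T, w t = fanV (pk t) (nx t) (pivot (pk t) (nx t)) := fun t ht =>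
    (vizingPath_of_primed (hmem t ht).2).2.2
  have hadj : ∀ t ∈ T, G.Adj (nx t).u (w t) := by
    intro t ht
    rw [hwv t ht]
    exact fanV_adj (h.next_valid hq t).1 (hmem t ht).1.1 (pivot_lt (hmem t ht).1.1).le
  have hfiber : T.card ≤ G.maxDegree * (T.image w).card := by
    refine Finset.card_le_mul_card_image T _ fun x _ => ?_
    refine le_trans ?_ (G.degree_le_maxDegree x)
    rw [← G.card_neighborFinset_eq_degree]
    refine Finset.card_le_card_of_injOn (fun t => (nx t).u) ?_ fun t _ t' _ he =>
      h.next_u_inj hq he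
    intro t ht
    obtain ⟨h1, rfl⟩ := Finset.mem_filter.1 ht
    simpa using (hadj t h1).symm
  -- The graph formed by the edges with the colors of `P` does not depend on the sample, except for
  -- the edge that loses its color.
  let H : V → V → Prop := fun x y => ∃ t, (nx t).χ s(x, y) = some P.fst ∨
    (nx t).χ s(x, y) = some P.snd
  have hH : ∀ {x y : V} (t : Fin L), H x y → s(x, y) ≠ s(P.vert (t + 1), P.vert (t + 1 + 1)) →
      (nx t).χ s(x, y) = some P.fst ∨ (nx t).χ s(x, y) = some P.snd := by
    rintro x y t ⟨t', ht'⟩ hne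
    rw [h.next_χ, truncColoring_mem_iff] at ht' ⊢
    exact ⟨hne, ht'.2⟩
  have hcount : (T.image w).card * (2 * L + 2) ≤ 2 * Fintype.card V := by
    have hex : ∀ x ∈ T.image w, ∃ t ∈ T, w t = x := fun x hx => Finset.mem_image.1 hx
    rcases T.eq_empty_or_nonempty with h0 | ⟨t₀, -⟩
    · simp [h0]
    have : Nonempty (Fin L) := ⟨t₀⟩
    obtain ⟨o, hc⟩ := h.exists_chain hq t₀
    have hl := h.length_gt t₀
    choose! g hgT hgw using hex
    refine card_mul_le_of_paths (H := H) ?_ ?_ _ (2 * L + 2)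
      (fun x => (vizingPath (pk (g x)) (nx (g x))).vert) ?_ ?_ ?_ ?_
    · rintro x y ⟨t, ht⟩
      refine ⟨t, ?_⟩
      rwa [Sym2.eq_swap]
    · intro x y₁ y₂ y₃ h1 h2 h3
      -- Some truncation removes an edge that does not contain `x`.
      obtain ⟨t, ht⟩ : ∃ t : Fin L, x ∉ s(P.vert (t + 1), P.vert (t + 1 + 1)) := by
        by_contra hcon
        push Not at hcon
        have c1 := Sym2.mem_iff.1 (hcon ⟨0, by omega⟩)
        have c2 := Sym2.mem_iff.1 (hcon ⟨2, by omega⟩)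
        have inj := fun {r r' : ℕ} (hr : r ≤ 4) (hr' : r' ≤ 4) (he : P.vert r = P.vert r') =>
          hc.vert_injOn (r := r) (r' := r') (by omega) (by omega) he
        rcases c1 with c1 | c1 <;> rcases c2 with c2 | c2
        all_goals
          have := inj (by simp) (by simp) (c1.symm.trans c2)
          simp at this
      have hx : ∀ y, s(x, y) ≠ s(P.vert (t + 1), P.vert (t + 1 + 1)) := by
        intro y he
        exact ht (he ▸ Sym2.mem_mk_left x y)
      have := (h.next_valid hq t).1.coloring.proper x
      rcases hH t h1 (hx _) with h1 | h1 <;> rcases hH t h2 (hx _) with h2 | h2 <;>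
        rcases hH t h3 (hx _) with h3 | h3
      all_goals first
        | exact Or.inl (this _ _ _ h1 h2)
        | exact Or.inr (Or.inl (this _ _ _ h1 h3))
        | exact Or.inr (Or.inr (this _ _ _ h2 h3))
    · intro x hx y hy he
      rw [← hgw x hx, ← hgw y hy]
      exact he
    · intro x hx r hr r' hr' he
      have hlong := (hmem _ (hgT x hx)).1
      obtain ⟨o', hc'⟩ := exists_isVizingChain (h.next_valid hq (g x)).1 hq
        (h.choice_next (g x)) hlong.1
      have := hlong.2
      exact hc'.vert_injOn (by omega) (by omega) he
    · intro x hx r hr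
      have hm := hmem _ (hgT x hx)
      have hcc := (h.next_valid hq (g x)).2.2
      obtain ⟨p1, p2, -⟩ := vizingPath_of_primed hm.2
      refine ⟨g x, ?_⟩
      have hwk := vizingPath_isAltWalk (pk (g x)) (nx (g x)) r (hr.trans hm.1.2)
      rw [p1, p2] at hwk
      rcases altColor_eq_or (nx (g x)).cu (nx (g x)).cv r with h3 | h3 <;> rw [h3] at hwk <;>
        rcases hcc with ⟨q1, q2⟩ | ⟨q1, q2⟩ <;> rw [hwk] <;> simp [q1, q2, hP]
    · intro x hx y z hy hz
      have hgx := hgT x hx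
      have hm := hmem _ hgx
      obtain ⟨hval, -, hcc⟩ := h.next_valid hq (g x)
      obtain ⟨o', hc'⟩ := exists_isVizingChain hval hq (h.choice_next (g x)) hm.1.1
      obtain ⟨p1, p2, -⟩ := vizingPath_of_primed hm.2
      have hmiss := hc'.start_miss
      rw [p2] at hmiss
      change H (w (g x)) y at hy
      change H (w (g x)) z at hz
      change _ ∈ miss _ (w (g x)) at hmiss
      -- The start of the path is not on the edge that lost its color.
      have hne : w (g x) ∉ s(P.vert (g x + 1), P.vert (g x + 1 + 1)) := by
        rw [← h.next_u, ← h.next_v, Sym2.mem_iff]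
        rintro (h1 | h1)
        · exact (hadj _ hgx).ne h1.symm
        · rw [hwv _ hgx] at h1
          have h0 : pivot (pk (g x)) (nx (g x)) = 0 :=
            fanV_inj hval hm.1.1 (pivot_lt hm.1.1).le (Nat.zero_le _) h1
          refine fanC_zero_ne hval hq (h.choice_next (g x)) ?_
          rw [← h0, pivot_spec]
          exact hm.2
      have hne' : ∀ y, s(w (g x), y) ≠ s(P.vert (g x + 1), P.vert (g x + 1 + 1)) := by
        intro y he
        exact hne (he ▸ Sym2.mem_mk_left _ y)
      have hy' := hH (g x) hy (hne' y)
      have hz' := hH (g x) hz (hne' z)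
      rcases hcc with ⟨q1, q2⟩ | ⟨q1, q2⟩ <;> rw [q2] at hmiss
      · exact hval.coloring.proper _ _ _ _ (hy'.resolve_right (mem_miss.1 hmiss y))
          (hz'.resolve_right (mem_miss.1 hmiss z))
      · exact hval.coloring.proper _ _ _ _ (hy'.resolve_left (mem_miss.1 hmiss y))
          (hz'.resolve_left (mem_miss.1 hmiss z))
  calc T.card * (2 * L + 2) ≤ G.maxDegree * (T.image w).card * (2 * L + 2) :=
        Nat.mul_le_mul_right _ hfiber
    _ = G.maxDegree * ((T.image w).card * (2 * L + 2)) := by ring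
    _ ≤ _ := Nat.mul_le_mul_left _ hcount

open Classical in
/-- There are few samples after which the next path is long and uses one of the colors in `C`. -/
lemma card_mem_colors_mul_le (h : IsStep G L pick s pk nx) (hq : G.maxDegree < q)
    (C : Finset (Fin q)) :
    (Finset.univ.filter fun t : Fin L => IsLong L (pk t) (nx t) ∧ ¬ Primed (pk t) (nx t) ∧
      ((vizingPath (pk t) (nx t)).fst ∈ C ∨ (vizingPath (pk t) (nx t)).snd ∈ C)).card *
      (2 * L + 2) ≤ 2 * C.card * q * (2 * Fintype.card V) := by
  set T := Finset.univ.filter fun t : Fin L => IsLong L (pk t) (nx t) ∧ ¬ Primed (pk t) (nx t) ∧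
      ((vizingPath (pk t) (nx t)).fst ∈ C ∨ (vizingPath (pk t) (nx t)).snd ∈ C) with hT
  let K : Finset (Fin q × Fin q) := C ×ˢ Finset.univ ∪ Finset.univ ×ˢ C
  have hK : K.card ≤ 2 * C.card * q := by
    refine (Finset.card_union_le _ _).trans ?_
    rw [Finset.card_product, Finset.card_product, Finset.card_univ, Fintype.card_fin]
    nlinarith
  rw [Finset.card_eq_sum_card_fiberwise (t := K)
    (f := fun t => ((vizingPath (pk t) (nx t)).fst, (vizingPath (pk t) (nx t)).snd)),
    Finset.sum_mul]
  · refine (Finset.sum_le_card_nsmul _ _ (2 * Fintype.card V) ?_).trans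
      (Nat.mul_le_mul_right _ hK)
    rintro ⟨a, b⟩ -
    refine le_trans (Nat.mul_le_mul_right _ (Finset.card_le_card ?_))
      (h.card_colors_mul_le hq a b)
    intro t ht
    simp only [hT, Finset.mem_filter, Finset.mem_univ, true_and, Prod.mk.injEq] at ht ⊢
    tauto
  · intro t ht
    simp only [hT, Finset.coe_filter, Finset.mem_univ, true_and, Set.mem_ofPred_eq] at ht
    simp only [K, Finset.coe_union, Set.mem_union, Finset.mem_coe, Finset.mem_product,
      Finset.mem_univ, true_and, and_true]
    tauto

open Classical in
/-- There are few samples after which the next path is long and runs into the set `U`. -/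
lemma card_hits_le (h : IsStep G L pick s pk nx) (hq : G.maxDegree < q) (U : Finset V) :
    (Finset.univ.filter fun t : Fin L => IsLong L (pk t) (nx t) ∧ ¬ Primed (pk t) (nx t) ∧
      ∃ r ≤ 2 * L + 2, (vizingPath (pk t) (nx t)).vert r ∈ U).card ≤ 2 * q ^ 2 * U.card := by
  set T := Finset.univ.filter fun t : Fin L => IsLong L (pk t) (nx t) ∧ ¬ Primed (pk t) (nx t) ∧
      ∃ r ≤ 2 * L + 2, (vizingPath (pk t) (nx t)).vert r ∈ U with hT
  rcases T.eq_empty_or_nonempty with h0 | ⟨t₀, -⟩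
  · simp [h0]
  have hmem : ∀ t ∈ T, IsLong L (pk t) (nx t) ∧ ¬ Primed (pk t) (nx t) ∧
      ∃ r ≤ 2 * L + 2, (vizingPath (pk t) (nx t)).vert r ∈ U := by
    intro t ht
    simpa [hT] using ht
  have hex : ∀ t ∈ T, ∃ r ≤ 2 * L + 2, (vizingPath (pk t) (nx t)).vert r ∈ U :=
    fun t ht => (hmem t ht).2.2
  choose! r hr hrU using hex
  have hle : T.card ≤ ((Finset.univ : Finset (Fin q × Fin q × Bool)) ×ˢ U).card := by
    refine Finset.card_le_card_of_injOn (fun t => (((vizingPath (pk t) (nx t)).fst,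
      (vizingPath (pk t) (nx t)).snd, decide (Even (r t))), (vizingPath (pk t) (nx t)).vert (r t)))
      ?_ ?_
    · intro t ht
      simpa using hrU t ht
    · intro t ht t' ht' he
      have ht1 := hmem t ht
      have ht2 := hmem t' ht'
      simp only [Prod.mk.injEq, decide_eq_decide] at he
      obtain ⟨⟨e1, e2, e3⟩, e4⟩ := he
      have w1 := h.next_walk hq t t₀ ht1.1 ht1.2.1
      have w2 := h.next_walk hq t' t₀ ht2.1 ht2.2.1
      rw [← e1, ← e2] at w2
      have l1 := ht1.1.2
      have l2 := ht2.1.2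
      have g1 := hr t ht
      have g2 := hr t' ht'
      have := (w1.1.mono (show r t ≤ _ by omega)).unique (h.next_valid hq t₀).1.coloring
        (w2.1.mono (show r t' ≤ _ by omega)) w1.2 w2.2 e3 e4
      have h5 := this.2
      rw [(vizingPath_of_not_primed ht1.2.1).2.2, (vizingPath_of_not_primed ht2.2.1).2.2] at h5
      exact h.next_u_inj hq h5
  refine hle.trans (le_of_eq ?_)
  simp only [Finset.card_product, Finset.card_univ, Fintype.card_prod, Fintype.card_fin,
    Fintype.card_bool]
  ring

open Classical in
lemma card_adj_le (h : IsStep G L pick s pk nx) (hq : G.maxDegree < q) (U : Finset V) :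
    (Finset.univ.filter fun t : Fin L => ∃ y ∈ U, G.Adj (nx t).u y).card ≤
      U.card * G.maxDegree := by
  refine le_trans ?_ (Finset.card_biUnion_le_card_mul U (fun y => G.neighborFinset y) G.maxDegree
    fun y _ => by rw [G.card_neighborFinset_eq_degree]; exact G.degree_le_maxDegree y)
  refine Finset.card_le_card_of_injOn (fun t => (nx t).u) ?_ fun t _ t' _ he => h.next_u_inj hq he
  intro t ht
  obtain ⟨y, hy, hadj⟩ := (Finset.mem_filter.1 ht).2
  simp only [Finset.coe_biUnion, Set.mem_iUnion]
  exact ⟨y, hy, by simpa using hadj.symm⟩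

end IsStep

/-- An iteration, which follows iterations with path colors `C` and fan centers `U`, goes on, but
its path cannot be read off from the initial coloring. -/
def IsBad (G : SimpleGraph V) (L : ℕ) (pick : Choice q) (s : State V q) (C : Finset (Fin q))
    (U : Finset V) : Prop :=
  IsLong L pick s ∧ (Primed pick s ∨
    ((vizingPath pick s).fst ∈ C ∨ (vizingPath pick s).snd ∈ C) ∨
    (∃ r ≤ 2 * L + 2, (vizingPath pick s).vert r ∈ U) ∨ ∃ y ∈ U, G.Adj s.u y)

open Classical in
/-- The number of unfavorable samples of one iteration. -/
lemma IsStep.card_bad_mul_le {G : SimpleGraph V} [DecidableRel G.Adj] {L : ℕ} {pick : Choice q}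
    {s : State V q} {pk : Fin L → Choice q} {nx : Fin L → State V q}
    (h : IsStep G L pick s pk nx) (hq : G.maxDegree < q) (hL : 3 ≤ L) (C : Finset (Fin q))
    (U : Finset V) :
    (Finset.univ.filter fun t : Fin L => IsBad G L (pk t) (nx t) C U).card * (2 * L + 2) ≤
      (G.maxDegree + 2 * C.card * q) * (2 * Fintype.card V) +
        U.card * (2 * q ^ 2 + G.maxDegree) * (2 * L + 2) := by
  have h1 := h.card_primed_mul_le hq hL
  have h2 := h.card_mem_colors_mul_le hq C
  have h3 := Nat.mul_le_mul_right (2 * L + 2) (h.card_hits_le hq U)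
  have h4 := Nat.mul_le_mul_right (2 * L + 2) (h.card_adj_le hq U)
  set T₁ := Finset.univ.filter fun t : Fin L => IsLong L (pk t) (nx t) ∧ Primed (pk t) (nx t)
  set T₂ := Finset.univ.filter fun t : Fin L => IsLong L (pk t) (nx t) ∧ ¬ Primed (pk t) (nx t) ∧
      ((vizingPath (pk t) (nx t)).fst ∈ C ∨ (vizingPath (pk t) (nx t)).snd ∈ C)
  set T₃ := Finset.univ.filter fun t : Fin L => IsLong L (pk t) (nx t) ∧ ¬ Primed (pk t) (nx t) ∧
      ∃ r ≤ 2 * L + 2, (vizingPath (pk t) (nx t)).vert r ∈ U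
  set T₄ := Finset.univ.filter fun t : Fin L => ∃ y ∈ U, G.Adj (nx t).u y
  have hsub : (Finset.univ.filter fun t : Fin L => IsBad G L (pk t) (nx t) C U) ⊆
      T₁ ∪ T₂ ∪ (T₃ ∪ T₄) := by
    intro t ht
    have ht' : IsBad G L (pk t) (nx t) C U := (Finset.mem_filter.1 ht).2
    unfold IsBad at ht'
    simp only [T₁, T₂, T₃, T₄, Finset.mem_union, Finset.mem_filter, Finset.mem_univ, true_and]
    obtain ⟨hl, hb⟩ := ht'
    by_cases hp : Primed (pk t) (nx t)
    · exact Or.inl (Or.inl ⟨hl, hp⟩)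
    · rcases hb.resolve_left hp with hb | hb | hb
      · exact Or.inl (Or.inr ⟨hl, hp, hb⟩)
      · exact Or.inr (Or.inl ⟨hl, hp, hb⟩)
      · exact Or.inr (Or.inr hb)
  have hcard := (Finset.card_le_card hsub).trans ((Finset.card_union_le _ _).trans
    (Nat.add_le_add (Finset.card_union_le _ _) (Finset.card_union_le _ _)))
  have h5 := Nat.mul_le_mul_right (2 * L + 2) hcard
  nlinarith

end OneStep

/-! ### The course of the algorithm -/

section Run

variable {V : Type*} {q : ℕ} [Fintype V] [DecidableEq V] {L : ℕ}
  (pick : List (Fin L) → Choice q) (s : State V q)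

/-- The samples drawn in the first `i` iterations. -/
def history (x : ℕ → Fin L) (i : ℕ) : List (Fin L) := (List.range i).map x

lemma history_congr {x y : ℕ → Fin L} {i : ℕ} (h : ∀ j < i, x j = y j) :
    history x i = history y i :=
  List.map_congr_left fun j hj => h j (List.mem_range.1 hj)

lemma run_congr {x y : ℕ → Fin L} {i : ℕ} (h : ∀ j < i, x j = y j) :
    run pick s x i = run pick s y i := by
  induction i with
  | zero => rfl
  | succ i ih =>
    have h1 : (List.range i).map x = (List.range i).map y :=
      history_congr fun j hj => h j (by omega)
    rw [run, run, ih fun j hj => h j (by omega), h i (Nat.lt_succ_self i), h1]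

/-- The algorithm does not return within `i` iterations. -/
def Goes (x : ℕ → Fin L) (i : ℕ) : Prop := ∃ s', run pick s x i = .inl s'

/-- The state after `i` iterations; it has no meaning once the algorithm has returned. -/
noncomputable def stateAt (x : ℕ → Fin L) (i : ℕ) : State V q := (run pick s x i).elim id fun _ => s

/-- The path of the iteration with index `i` (starting at `0`). -/
noncomputable def pathAt (x : ℕ → Fin L) (i : ℕ) : AltPath V q :=
  vizingPath (pick (history x i)) (stateAt pick s x i)

/-- The colors of the paths of the first `i` iterations. -/
noncomputable def colorsUpTo (x : ℕ → Fin L) (i : ℕ) : Finset (Fin q) :=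
  (Finset.range i).biUnion fun j => {(pathAt pick s x j).fst, (pathAt pick s x j).snd}

/-- The centers of the fans of the first `i` iterations. -/
noncomputable def centersUpTo (x : ℕ → Fin L) (i : ℕ) : Finset V :=
  (Finset.range i).image fun j => (stateAt pick s x j).u

variable {pick s} {x y : ℕ → Fin L} {i : ℕ}

lemma goes_congr (h : ∀ j < i, x j = y j) : Goes pick s x i ↔ Goes pick s y i := by
  rw [Goes, Goes, run_congr pick s h]

lemma stateAt_congr (h : ∀ j < i, x j = y j) : stateAt pick s x i = stateAt pick s y i := by
  rw [stateAt, stateAt, run_congr pick s h]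

lemma pathAt_congr (h : ∀ j < i, x j = y j) : pathAt pick s x i = pathAt pick s y i := by
  rw [pathAt, pathAt, stateAt_congr h, history_congr h]

lemma colorsUpTo_congr (h : ∀ j < i, x j = y j) :
    colorsUpTo pick s x (i + 1) = colorsUpTo pick s y (i + 1) := by
  refine Finset.biUnion_congr rfl fun j hj => ?_
  have hj' := Finset.mem_range.1 hj
  rw [pathAt_congr fun k hk => h k (by omega)]

lemma centersUpTo_congr (h : ∀ j < i, x j = y j) :
    centersUpTo pick s x (i + 1) = centersUpTo pick s y (i + 1) := by
  refine Finset.image_congr fun j hj => ?_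
  have hj' := Finset.mem_range.1 hj
  rw [stateAt_congr fun k hk => h k (by omega)]

lemma card_colorsUpTo_le : (colorsUpTo pick s x i).card ≤ 2 * i := by
  refine (Finset.card_biUnion_le_card_mul _ _ 2 fun j _ => Finset.card_le_two).trans ?_
  rw [Finset.card_range, mul_comm]

lemma card_centersUpTo_le : (centersUpTo pick s x i).card ≤ i :=
  Finset.card_image_le.trans (Finset.card_range i).le

lemma Goes.run_eq (h : Goes pick s x i) : run pick s x i = .inl (stateAt pick s x i) := by
  obtain ⟨s', hs'⟩ := h
  rw [stateAt, hs']
  rfl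

lemma run_succ (h : Goes pick s x i) : run pick s x (i + 1) =
    iteration (pick (history x i)) (stateAt pick s x i) L (x i + 1) := by
  rw [run, h.run_eq]
  rfl

lemma Goes.of_succ (h : Goes pick s x (i + 1)) : Goes pick s x i := by
  obtain ⟨s', hs'⟩ := h
  rw [run] at hs'
  split at hs'
  · rename_i s'' h''
    exact ⟨s'', h''⟩
  · cases hs'

lemma Goes.mono (h : Goes pick s x i) {j : ℕ} (hj : j ≤ i) : Goes pick s x j := by
  induction i with
  | zero => rwa [Nat.le_zero.1 hj]
  | succ i ih =>
    rcases hj.lt_or_eq with hj | rfl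
    · exact ih h.of_succ (by omega)
    · exact h

lemma Goes.iteration_eq (h : Goes pick s x (i + 1)) :
    iteration (pick (history x i)) (stateAt pick s x i) L (x i + 1) =
      .inl (stateAt pick s x (i + 1)) := by
  rw [← run_succ h.of_succ, h.run_eq]

lemma Goes.isLong (h : Goes pick s x (i + 1)) :
    IsLong L (pick (history x i)) (stateAt pick s x i) :=
  have h1 := iteration_eq_inl (by omega) h.iteration_eq
  ⟨h1.1, h1.2.1⟩

lemma exists_iteration_eq_inl {pick : Choice q} (h : IsLong L pick s) (hi : i ≤ L) :
    ∃ s', iteration pick s L i = .inl s' := by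
  obtain ⟨h1, h2⟩ := h
  unfold iteration truncatedVizing
  rw [if_neg (by push Not; exact ⟨h1, h2⟩), if_neg (by push Not; exact ⟨h1, by omega⟩)]
  exact ⟨_, rfl⟩

variable {G : SimpleGraph V} [DecidableRel G.Adj]

lemma Goes.isValid (h : Goes pick s x i) (hs : s.IsValid G) (hq : G.maxDegree < q)
    (hpick : ∀ l, IsChoice (pick l)) : (stateAt pick s x i).IsValid G := by
  induction i with
  | zero => exact hs
  | succ i ih =>
    exact (iteration_valid (ih h.of_succ) hq (hpick _) (Nat.succ_pos _) (by omega)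
      h.iteration_eq).1

lemma Goes.isStep (h : Goes pick s x (i + 1)) (hs : s.IsValid G) (hq : G.maxDegree < q)
    (hpick : ∀ l, IsChoice (pick l)) :
    IsStep G L (pick (history x i)) (stateAt pick s x i)
      (fun t => pick (history (Function.update x i t) (i + 1)))
      (fun t => stateAt pick s (Function.update x i t) (i + 1)) where
  valid := h.of_succ.isValid hs hq hpick
  choice := hpick _
  choice_next _ := hpick _
  next t := by
    have hc : ∀ j < i, x j = Function.update x i t j := fun j hj =>
      (Function.update_of_ne hj.ne _ _).symm
    have hg : Goes pick s (Function.update x i t) i := (goes_congr hc).1 h.of_succ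
    have hr := run_succ hg
    rw [← history_congr hc, ← stateAt_congr hc, Function.update_self] at hr
    obtain ⟨s', hs'⟩ := exists_iteration_eq_inl h.isLong (show (t : ℕ) + 1 ≤ L by omega)
    have hg' : Goes pick s (Function.update x i t) (i + 1) := ⟨s', by rw [hr, hs']⟩
    rw [← hr, hg'.run_eq]

/-- Away from the centers of the fans, only the colors of the paths are ever moved. -/
lemma Goes.color_iff (h : Goes pick s x i) (hs : s.IsValid G) (hq : G.maxDegree < q)
    (hpick : ∀ l, IsChoice (pick l)) {e : Sym2 V} {d : Fin q} (hd : d ∉ colorsUpTo pick s x i)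
    (he : ∀ y ∈ centersUpTo pick s x i, y ∉ e) :
    (stateAt pick s x i).χ e = some d ↔ s.χ e = some d := by
  induction i with
  | zero => rfl
  | succ i ih =>
    have hstep := h.isStep hs hq hpick
    have h1 := hstep.next_χ_iff_self hq (x i) (e := e) (d := d)
    rw [Function.update_eq_self] at h1
    rw [h1, ih h.of_succ]
    · intro hd'
      refine hd ?_
      rw [colorsUpTo, Finset.mem_biUnion] at hd' ⊢
      obtain ⟨j, hj, hd'⟩ := hd'
      exact ⟨j, Finset.mem_range.2 (by have := Finset.mem_range.1 hj; omega), hd'⟩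
    · intro y hy
      refine he y ?_
      rw [centersUpTo, Finset.mem_image] at hy ⊢
      obtain ⟨j, hj, hy⟩ := hy
      exact ⟨j, Finset.mem_range.2 (by have := Finset.mem_range.1 hj; omega), hy⟩
    · have hmem : ∀ d ∈ ({(pathAt pick s x i).fst, (pathAt pick s x i).snd} : Finset (Fin q)),
          d ∈ colorsUpTo pick s x (i + 1) := fun d hd =>
        Finset.mem_biUnion.2 ⟨i, Finset.self_mem_range_succ i, hd⟩
      constructor
      · rintro rfl
        exact hd (hmem _ (by simp [pathAt]))
      · rintro rfl
        exact hd (hmem _ (by simp [pathAt]))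
    · exact he _ (Finset.mem_image.2 ⟨i, Finset.self_mem_range_succ i, rfl⟩)

variable (G pick s)

/-- The iteration with index `i` goes on, and its path interferes with earlier iterations. -/
def BadAt (x : ℕ → Fin L) (i : ℕ) : Prop :=
  Goes pick s x i ∧ IsBad G L (pick (history x i)) (stateAt pick s x i)
    (colorsUpTo pick s x i) (centersUpTo pick s x i)

variable {G pick s}

open Classical in
/-- When all samples but the one of iteration `i` are fixed, few values of the latter make the next
iteration unfavorable. -/
lemma card_badAt_mul_le (hs : s.IsValid G) (hq : G.maxDegree < q)
    (hpick : ∀ l, IsChoice (pick l)) (hL : 3 ≤ L) (x : ℕ → Fin L) (i : ℕ) :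
    (Finset.univ.filter fun t : Fin L => BadAt pick s G (Function.update x i t) (i + 1)).card *
      (2 * L + 2) ≤ (G.maxDegree + 2 * (2 * (i + 1)) * q) * (2 * Fintype.card V) +
        (i + 1) * (2 * q ^ 2 + G.maxDegree) * (2 * L + 2) := by
  set T := Finset.univ.filter fun t : Fin L => BadAt pick s G (Function.update x i t) (i + 1)
  rcases T.eq_empty_or_nonempty with h0 | ⟨t₀, ht₀⟩
  · simp [h0]
  have hgo : Goes pick s (Function.update x i t₀) (i + 1) := (Finset.mem_filter.1 ht₀).2.1
  have hstep := hgo.isStep hs hq hpick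
  simp only [Function.update_idem] at hstep
  refine le_trans ?_ ((hstep.card_bad_mul_le hq hL (colorsUpTo pick s x (i + 1))
    (centersUpTo pick s x (i + 1))).trans ?_)
  · refine Nat.mul_le_mul_right _ (Finset.card_le_card fun t ht => ?_)
    have h1 := (Finset.mem_filter.1 ht).2.2
    have hc : ∀ j < i, Function.update x i t j = x j := fun j hj =>
      Function.update_of_ne hj.ne _ _
    rw [colorsUpTo_congr hc, centersUpTo_congr hc] at h1
    exact Finset.mem_filter.2 ⟨Finset.mem_univ _, h1⟩
  · gcongr
    · exact card_colorsUpTo_le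
    · exact card_centersUpTo_le

/-! ### Reconstructing the samples -/

/-- The path of a favorable iteration is already an alternating path of the initial coloring. -/
lemma Goes.walk_initial (h : Goes pick s x (i + 1)) (hs : s.IsValid G) (hq : G.maxDegree < q)
    (hpick : ∀ l, IsChoice (pick l)) (hb : ¬ BadAt pick s G x i) :
    IsAltWalk s.χ (pathAt pick s x i).vert (pathAt pick s x i).fst (pathAt pick s x i).snd
      (2 * L + 2) ∧ (pathAt pick s x i).snd ∈ miss s.χ ((pathAt pick s x i).vert 0) ∧
      (pathAt pick s x i).vert 0 = (stateAt pick s x i).u := by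
  have hlong := h.isLong
  have hval := h.of_succ.isValid hs hq hpick
  have hb' : ¬ _ := fun hb' => hb ⟨h.of_succ, hlong, hb'⟩
  push Not at hb'
  obtain ⟨hp, ⟨hfst, hsnd⟩, hhit, hadj⟩ := hb'
  have hstart := (vizingPath_of_not_primed hp).2.2
  refine ⟨fun r hr => ?_, ?_, hstart⟩
  · rw [← h.of_succ.color_iff hs hq hpick]
    · exact vizingPath_isAltWalk _ _ r (hr.trans hlong.2)
    · rcases altColor_eq_or (pathAt pick s x i).fst (pathAt pick s x i).snd r with h3 | h3 <;>
        rw [h3] <;> assumption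
    · intro y hy hye
      rcases Sym2.mem_iff.1 hye with rfl | rfl
      · exact hhit r (by omega) hy
      · exact hhit (r + 1) (by omega) hy
  · rw [mem_miss]
    intro w hw
    have hfar : ∀ y ∈ centersUpTo pick s x i, y ∉ s((pathAt pick s x i).vert 0, w) := by
      intro y hy hye
      rcases Sym2.mem_iff.1 hye with rfl | rfl
      · exact hhit 0 (by omega) hy
      · rw [pathAt, hstart] at hw
        exact hadj _ hy (hs.coloring.adj hw)
    have hw' := (h.of_succ.color_iff hs hq hpick hsnd hfar).2 hw
    rw [pathAt, hstart] at hw'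
    exact mem_miss.1 (snd_mem hval hq (hpick _) hp).1 w hw'

/-- Favorable samples can be reconstructed from the last vertex, the colors of the paths, and the
parities of the samples. -/
lemma samples_eq {m : ℕ} (hs : s.IsValid G) (hq : G.maxDegree < q)
    (hpick : ∀ l, IsChoice (pick l)) (hx : Goes pick s x m) (hy : Goes pick s y m)
    (hbx : ∀ i, i + 1 < m → ¬ BadAt pick s G x (i + 1))
    (hby : ∀ i, i + 1 < m → ¬ BadAt pick s G y (i + 1))
    (hlast : (stateAt pick s x m).u = (stateAt pick s y m).u)
    (hfst : ∀ i < m, (pathAt pick s x i).fst = (pathAt pick s y i).fst)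
    (hsnd : ∀ i < m, (pathAt pick s x i).snd = (pathAt pick s y i).snd)
    (hpar : ∀ i < m, Even (x i + 1 : ℕ) ↔ Even (y i + 1 : ℕ)) :
    ∀ i < m, x i = y i := by
  have next_u : ∀ {x : ℕ → Fin L} {i : ℕ}, Goes pick s x (i + 1) →
      (stateAt pick s x (i + 1)).u = (pathAt pick s x i).vert (x i + 1) := fun {x i} h =>
    (iteration_eq_inl (by omega) h.iteration_eq).2.2.2.1
  -- The centers agree, from the last one backwards.
  have hu : ∀ k < m, (stateAt pick s x (m - k)).u = (stateAt pick s y (m - k)).u := by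
    intro k
    induction k with
    | zero => exact fun _ => hlast
    | succ k ih =>
      intro hk
      obtain ⟨i, hi⟩ : ∃ i, m - (k + 1) = i + 1 := ⟨m - (k + 1) - 1, by omega⟩
      have ih' := ih (by omega)
      rw [show m - k = i + 1 + 1 by omega] at ih'
      rw [hi]
      have gx := hx.mono (show i + 1 + 1 ≤ m by omega)
      have gy := hy.mono (show i + 1 + 1 ≤ m by omega)
      rw [next_u gx, next_u gy] at ih'
      obtain ⟨w1, w2, w3⟩ := gx.walk_initial hs hq hpick (hbx i (by omega))
      obtain ⟨z1, z2, z3⟩ := gy.walk_initial hs hq hpick (hby i (by omega))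
      rw [← hfst _ (by omega), ← hsnd _ (by omega)] at z1
      rw [← hsnd _ (by omega)] at z2
      rw [← w3, ← z3]
      exact ((w1.mono (show (x (i + 1) + 1 : ℕ) ≤ _ by omega)).unique hs.coloring
        (z1.mono (show (y (i + 1) + 1 : ℕ) ≤ _ by omega)) w2 z2 (hpar _ (by omega)) ih').2
  -- The samples agree, from the first one forwards.
  intro i
  induction i using Nat.strong_induction_on with
  | _ i ih =>
    intro hi
    have hc : ∀ j < i, x j = y j := fun j hj => ih j hj (by omega)
    have gx := hx.mono (show i + 1 ≤ m by omega)
    have gy := hy.mono (show i + 1 ≤ m by omega)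
    have h1 := hu (m - (i + 1)) (by omega)
    rw [show m - (m - (i + 1)) = i + 1 by omega, next_u gx, next_u gy, ← pathAt_congr hc] at h1
    obtain ⟨o, hch⟩ := exists_isVizingChain (gx.of_succ.isValid hs hq hpick) hq (hpick _)
      gx.isLong.1
    have hl := gx.isLong.2
    have := hch.vert_injOn (by omega) (by omega) h1
    exact Fin.ext (by omega)

end Run

/-! ### Counting tuples of samples -/

section Tuples

open Classical in
/-- If every line in direction `i` contains few points of a set of tuples, the set is small. -/
lemma card_mul_le_of_update {L m : ℕ} (p : (Fin m → Fin L) → Prop) (i : Fin m) (K B : ℕ)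
    (h : ∀ x, (Finset.univ.filter fun t => p (Function.update x i t)).card * K ≤ B) :
    (Finset.univ.filter p).card * L * K ≤ B * L ^ m := by
  -- A tuple and a new value are exchanged with the updated tuple and the old value.
  have hinv : Function.Involutive fun z : (Fin m → Fin L) × Fin L =>
      (Function.update z.1 i z.2, z.1 i) := by
    rintro ⟨x, t⟩
    simp
  have h1 : ∑ x : Fin m → Fin L, (Finset.univ.filter fun t => p (Function.update x i t)).card =
      (Finset.univ.filter p).card * L := by
    simp only [Finset.card_filter]
    rw [← Fintype.sum_prod_type' (f := fun x t => if p (Function.update x i t) then 1 else 0)]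
    rw [← Equiv.sum_comp hinv.toPerm, Fintype.sum_prod_type, Finset.sum_mul]
    simp
  rw [← h1, Finset.sum_mul]
  refine (Finset.sum_le_card_nsmul _ _ B fun x _ => h x).trans (le_of_eq ?_)
  simp [mul_comm]

variable {V : Type*} {q : ℕ} [Fintype V] [DecidableEq V] {L : ℕ}
  {pick : List (Fin L) → Choice q} {s : State V q} {G : SimpleGraph V} [DecidableRel G.Adj]

/-- A tuple, extended to a sequence by arbitrary values. -/
def extend (hL : 0 < L) {m : ℕ} (x : Fin m → Fin L) (j : ℕ) : Fin L :=
  if h : j < m then x ⟨j, h⟩ else ⟨0, hL⟩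

lemma extend_update (hL : 0 < L) {m : ℕ} (x : Fin m → Fin L) (i : Fin m) (t : Fin L) :
    extend hL (Function.update x i t) = Function.update (extend hL x) i t := by
  funext j
  by_cases hj : j < m
  · by_cases hij : j = i
    · subst hij
      simp [extend]
    · have : (⟨j, hj⟩ : Fin m) ≠ i := fun h => hij (by rw [← h])
      simp [extend, hj, Function.update_of_ne hij, Function.update_of_ne this]
  · have hij : j ≠ i := by omega
    simp [extend, hj, Function.update_of_ne hij]

open Classical in
/-- The number of favorable tuples, bounded by the number of choices of a vertex, and of two
colors and a parity for each sample. -/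
lemma card_favorable_le (hs : s.IsValid G) (hq : G.maxDegree < q)
    (hpick : ∀ l, IsChoice (pick l)) (hL : 0 < L) (m : ℕ) :
    (Finset.univ.filter fun x : Fin m → Fin L => Goes pick s (extend hL x) m ∧
      ∀ i, i + 1 < m → ¬ BadAt pick s G (extend hL x) (i + 1)).card ≤
      Fintype.card V * (2 * q ^ 2) ^ m := by
  have hcard : Fintype.card (V × (Fin m → Fin q × Fin q × Bool)) =
      Fintype.card V * (2 * q ^ 2) ^ m := by
    simp only [Fintype.card_prod, Fintype.card_pi, Fintype.card_fin, Fintype.card_bool,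
      Finset.prod_const, Finset.card_univ]
    congr 2
    ring
  rw [← hcard, ← Finset.card_univ]
  refine Finset.card_le_card_of_injOn (fun x => ((stateAt pick s (extend hL x) m).u,
    fun i : Fin m => ((pathAt pick s (extend hL x) i).fst, (pathAt pick s (extend hL x) i).snd,
      decide (Even (extend hL x i + 1 : ℕ))))) (fun _ _ => Finset.mem_coe.2 (Finset.mem_univ _)) ?_
  intro x hx y hy he
  have hx' := (Finset.mem_filter.1 hx).2
  have hy' := (Finset.mem_filter.1 hy).2
  simp only [Prod.mk.injEq] at he
  have he2 := fun i hi => congrFun he.2 (⟨i, hi⟩ : Fin m)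
  simp only [Prod.mk.injEq, decide_eq_decide] at he2
  have := samples_eq hs hq hpick hx'.1 hy'.1 hx'.2 hy'.2 he.1 (fun i hi => (he2 i hi).1)
    (fun i hi => (he2 i hi).2.1) (fun i hi => (he2 i hi).2.2)
  funext i
  simpa [extend] using this i i.2

open Classical in
lemma card_goes_le (hs : s.IsValid G) (hq : G.maxDegree < q)
    (hpick : ∀ l, IsChoice (pick l)) (hL : 0 < L) (m : ℕ) :
    (Finset.univ.filter fun x : Fin m → Fin L => Goes pick s (extend hL x) m).card ≤
      Fintype.card V * (2 * q ^ 2) ^ m + ∑ i ∈ Finset.range (m - 1),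
        (Finset.univ.filter fun x : Fin m → Fin L =>
          BadAt pick s G (extend hL x) (i + 1)).card := by
  refine le_trans (Finset.card_le_card (t := (Finset.univ.filter fun x : Fin m → Fin L =>
    Goes pick s (extend hL x) m ∧ ∀ i, i + 1 < m → ¬ BadAt pick s G (extend hL x) (i + 1)) ∪
    (Finset.range (m - 1)).biUnion fun i => Finset.univ.filter fun x : Fin m → Fin L =>
          BadAt pick s G (extend hL x) (i + 1)) ?_)
    ((Finset.card_union_le _ _).trans (Nat.add_le_add (card_favorable_le hs hq hpick hL m)
      Finset.card_biUnion_le))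
  intro x hx
  have hx' := (Finset.mem_filter.1 hx).2
  by_cases hb : ∀ i, i + 1 < m → ¬ BadAt pick s G (extend hL x) (i + 1)
  · exact Finset.mem_union_left _ (Finset.mem_filter.2 ⟨Finset.mem_univ _, hx', hb⟩)
  · push Not at hb
    obtain ⟨i, hi, hb⟩ := hb
    exact Finset.mem_union_right _ (Finset.mem_biUnion.2 ⟨i, Finset.mem_range.2 (by omega),
      Finset.mem_filter.2 ⟨Finset.mem_univ _, hb⟩⟩)

open Classical in
lemma card_badAt_tuples_mul_le (hs : s.IsValid G) (hq : G.maxDegree < q)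
    (hpick : ∀ l, IsChoice (pick l)) (hL : 3 ≤ L) {m i : ℕ} (hi : i < m) :
    (Finset.univ.filter fun x : Fin m → Fin L =>
      BadAt pick s G (extend (by omega) x) (i + 1)).card * L * (2 * L + 2) ≤
      ((G.maxDegree + 2 * (2 * (i + 1)) * q) * (2 * Fintype.card V) +
        (i + 1) * (2 * q ^ 2 + G.maxDegree) * (2 * L + 2)) * L ^ m := by
  refine card_mul_le_of_update _ ⟨i, hi⟩ _ _ fun x => ?_
  simp only [extend_update]
  exact card_badAt_mul_le hs hq hpick hL _ i

end Tuples

/-! ### Probabilities -/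

section Probability

open MeasureTheory ProbabilityTheory

open Classical in
lemma measureReal_tuple_le {Ω : Type*} [MeasurableSpace Ω] {μ : Measure Ω}
    [IsProbabilityMeasure μ] {L : ℕ} {X : ℕ → Ω → Fin L} (hindep : iIndepFun X μ)
    (hunif : ∀ j a, μ.real {ω | X j ω = a} = 1 / L) {m : ℕ} (p : (Fin m → Fin L) → Prop) :
    μ.real {ω | p fun j => X j ω} ≤ (Finset.univ.filter p).card * (1 / L : ℝ) ^ m := by
  have hsingle : ∀ a : Fin m → Fin L,
      μ.real (⋂ j ∈ (Finset.univ : Finset (Fin m)), X j ⁻¹' {a j}) = (1 / L : ℝ) ^ m := by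
    intro a
    have h := (hindep.precomp (g := fun j : Fin m => (j : ℕ)) Fin.val_injective
      ).measure_inter_preimage_eq_mul Finset.univ (sets := fun j => {a j})
      fun _ _ => MeasurableSet.of_discrete
    rw [Measure.real, h, ENNReal.toReal_prod]
    have h1 : ∀ j : Fin m, (μ (X j ⁻¹' {a j})).toReal = 1 / L := fun j => hunif j (a j)
    simp [h1]
  have hsub : {ω | p fun j => X j ω} ⊆ ⋃ a ∈ Finset.univ.filter p,
      ⋂ j ∈ (Finset.univ : Finset (Fin m)), X j ⁻¹' {a j} := by
    intro ω hω
    simp only [Set.mem_iUnion, Set.mem_iInter]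
    exact ⟨fun j => X j ω, Finset.mem_filter.2 ⟨Finset.mem_univ _, hω⟩, fun j _ => rfl⟩
  refine (measureReal_mono hsub (measure_ne_top _ _)).trans
    ((measureReal_biUnion_finset_le _ _).trans (le_of_eq ?_))
  simp only [hsingle, Finset.sum_const, nsmul_eq_mul]

end Probability

section Estimates

variable {n D L : ℕ}

lemma ell_ge (hn : 2 ≤ n) : 69 ≤ ell n := by
  have h1 : Real.log 2 ≤ Real.log n := Real.log_le_log (by norm_num) (by exact_mod_cast hn)
  have h2 := Real.log_two_gt_d9
  rw [ell]
  linarith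

lemma truncLen_ge (hn : 2 ≤ n) :
    1000 * ell n ^ 2 * (D : ℝ) ^ 2 ≤ truncLen n D ∧
      1000000 * ell n ^ 4 * ((D : ℝ) * n) ≤ (truncLen n D : ℝ) ^ 2 := by
  have hl := ell_ge hn
  have h1 : 10 ^ 3 * ell n ^ 2 * ((D : ℝ) ^ 2 + √((D : ℝ) * n)) ≤ truncLen n D := Nat.le_ceil _
  have hs := Real.sqrt_nonneg ((D : ℝ) * n)
  have hss : √((D : ℝ) * n) ^ 2 = (D : ℝ) * n := Real.sq_sqrt (by positivity)
  have hA : 0 ≤ 1000 * ell n ^ 2 * (D : ℝ) ^ 2 := by positivity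
  have hB : 0 ≤ 1000 * ell n ^ 2 * √((D : ℝ) * n) := by positivity
  have h2 : 1000 * ell n ^ 2 * √((D : ℝ) * n) ≤ truncLen n D := by linarith
  refine ⟨by linarith, ?_⟩
  calc 1000000 * ell n ^ 4 * ((D : ℝ) * n) = (1000 * ell n ^ 2 * √((D : ℝ) * n)) ^ 2 := by
        rw [mul_pow, hss]; ring
    _ ≤ _ := pow_le_pow_left₀ hB h2 2

/-- At most a quarter of all tuples are favorable. -/
lemma favorable_estimate (hn : 2 ≤ n) (hD : 1 ≤ D) {m : ℕ} (hm : ell n ≤ m) (hm1 : 1 ≤ m) :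
    4 * ((n * (2 * (D + 1) ^ 2) ^ m : ℕ) : ℝ) ≤ (truncLen n D : ℝ) ^ m := by
  have hl := ell_ge hn
  have hn0 : (0 : ℝ) < n := by exact_mod_cast (by omega : 0 < n)
  have hD' : (1 : ℝ) ≤ D := by exact_mod_cast hD
  -- The number of vertices is exponential in `m`, with a base that is small compared to `L`.
  have h1 : (n : ℝ) ≤ 3 ^ m := by
    have hlog : Real.log n ≤ m := by
      have : ell n = 10 ^ 2 * Real.log n := rfl
      linarith
    calc (n : ℝ) = Real.exp (Real.log n) := (Real.exp_log hn0).symm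
      _ ≤ Real.exp (m * 1) := Real.exp_le_exp.2 (by linarith)
      _ = Real.exp 1 ^ m := Real.exp_nat_mul 1 m
      _ ≤ 3 ^ m := pow_le_pow_left₀ (Real.exp_pos _).le (by linarith [Real.exp_one_lt_d9]) m
  have h2 : 12 * (2 * ((D : ℝ) + 1) ^ 2) ≤ truncLen n D := by
    have h3 := (truncLen_ge (D := D) hn).1
    have h4 : (69 : ℝ) ^ 2 ≤ ell n ^ 2 := pow_le_pow_left₀ (by norm_num) hl 2
    have h5 : (1 : ℝ) ≤ (D : ℝ) ^ 2 := one_le_pow₀ hD'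
    nlinarith
  have h4 : (4 : ℝ) ≤ 4 ^ m := le_self_pow₀ (by norm_num) (by omega)
  push_cast
  calc 4 * ((n : ℝ) * (2 * ((D : ℝ) + 1) ^ 2) ^ m)
      ≤ 4 ^ m * (3 ^ m * (2 * ((D : ℝ) + 1) ^ 2) ^ m) := by gcongr
    _ = (12 * (2 * ((D : ℝ) + 1) ^ 2)) ^ m := by
        rw [← mul_pow, ← mul_pow]; congr 1; ring
    _ ≤ _ := by gcongr

/-- The bound for the unfavorable samples of one of the first `ℓ + 1` iterations. -/
lemma bad_estimate (hn : 2 ≤ n) (hD : 1 ≤ D) {k : ℕ} (hk : (k : ℝ) ≤ ell n) :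
    (((D + 2 * (2 * k) * (D + 1)) * (2 * n) +
      k * (2 * (D + 1) ^ 2 + D) * (2 * truncLen n D + 2) : ℕ) : ℝ) * (8 * ell n) ≤
      truncLen n D * (2 * truncLen n D + 2) := by
  obtain ⟨h1, h2⟩ := truncLen_ge (D := D) hn
  have hl := ell_ge hn
  have hD' : (1 : ℝ) ≤ D := by exact_mod_cast hD
  have hk0 : (0 : ℝ) ≤ k := Nat.cast_nonneg k
  have hn0 : (0 : ℝ) ≤ n := Nat.cast_nonneg n
  set l := ell n
  set T : ℝ := (truncLen n D : ℝ)
  have hT0 : 0 ≤ T := Nat.cast_nonneg _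
  push_cast
  have e1 : (D : ℝ) + 2 * (2 * k) * (D + 1) ≤ 9 * l * D := by
    have : (k : ℝ) * (D + 1) ≤ l * (2 * D) := by gcongr; linarith
    nlinarith
  have e2 : (k : ℝ) * (2 * ((D : ℝ) + 1) ^ 2 + D) ≤ l * (9 * D ^ 2) := by
    gcongr
    nlinarith
  calc (((D : ℝ) + 2 * (2 * k) * (D + 1)) * (2 * n) +
        k * (2 * ((D : ℝ) + 1) ^ 2 + D) * (2 * T + 2)) * (8 * l)
      ≤ (9 * l * D * (2 * n) + l * (9 * D ^ 2) * (2 * T + 2)) * (8 * l) := by gcongr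
    _ = 144 * (l ^ 2 * (D * n)) + (72 * (l ^ 2 * D ^ 2)) * (2 * T + 2) := by ring
    _ ≤ T ^ 2 + (T / 2) * (2 * T + 2) := by
        have f1 : 144 * (l ^ 2 * (D * n)) ≤ T ^ 2 := by
          refine le_trans ?_ h2
          have : (1 : ℝ) ≤ l ^ 2 := one_le_pow₀ (by linarith)
          have g : l ^ 2 * ((D : ℝ) * n) ≤ l ^ 2 * (l ^ 2 * ((D : ℝ) * n)) := by
            exact mul_le_mul_of_nonneg_left (le_mul_of_one_le_left (by positivity) this)
              (by positivity)
          have g0 : 0 ≤ l ^ 2 * ((D : ℝ) * n) := by positivity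
          nlinarith
        have f2 : 72 * (l ^ 2 * (D : ℝ) ^ 2) ≤ T / 2 := by
          have : 0 ≤ l ^ 2 * (D : ℝ) ^ 2 := by positivity
          linarith
        gcongr
    _ ≤ T * (2 * T + 2) := by nlinarith

end Estimates

open Classical in
/-- At most half of all tuples of samples let the algorithm survive. -/
lemma two_mul_card_goes_le {V : Type*} [Fintype V] [DecidableEq V] {G : SimpleGraph V}
    [DecidableRel G.Adj] {L : ℕ} (hL : L = truncLen (Fintype.card V) G.maxDegree)
    {pick : List (Fin L) → Choice (G.maxDegree + 1)} {s : State V (G.maxDegree + 1)}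
    (hs : s.IsValid G) (hpick : ∀ l, IsChoice (pick l)) (hn : 2 ≤ Fintype.card V)
    (hD : 1 ≤ G.maxDegree) (hL3 : 3 ≤ L) {m : ℕ} (hm : ell (Fintype.card V) ≤ m)
    (hm' : (m : ℝ) ≤ ell (Fintype.card V) + 1) :
    2 * ((Finset.univ.filter fun x : Fin m → Fin L =>
      Goes pick s (extend (by omega) x) m).card : ℝ) ≤ (L : ℝ) ^ m := by
  have hl := ell_ge hn
  have hm1 : 1 ≤ m := by
    have : (1 : ℝ) ≤ m := by linarith
    exact_mod_cast this
  have hq : G.maxDegree < G.maxDegree + 1 := Nat.lt_succ_self _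
  have hL0 : (0 : ℝ) < L := by exact_mod_cast (by omega : 0 < L)
  have h1 := card_goes_le hs hq hpick (by omega : 0 < L) m
  have h2 := favorable_estimate hn hD hm hm1
  rw [← hL] at h2
  have h3 : ∀ i ∈ Finset.range (m - 1), ((Finset.univ.filter fun x : Fin m → Fin L =>
      BadAt pick s G (extend (by omega) x) (i + 1)).card : ℝ) ≤
      (L : ℝ) ^ m / (8 * ell (Fintype.card V)) := by
    intro i hi
    have hi' := Finset.mem_range.1 hi
    have hk : ((i + 1 : ℕ) : ℝ) ≤ ell (Fintype.card V) := by
      have : ((i + 1 + 1 : ℕ) : ℝ) ≤ m := by exact_mod_cast (by omega : i + 1 + 1 ≤ m)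
      push_cast at this ⊢
      linarith
    have h4 := bad_estimate hn hD hk
    have h5 : ((_ : ℕ) : ℝ) ≤ ((_ : ℕ) : ℝ) :=
      Nat.cast_le.2 (card_badAt_tuples_mul_le hs hq hpick hL3 (show i < m by omega))
    rw [← hL] at h4
    rw [Nat.cast_mul, Nat.cast_mul, Nat.cast_mul, Nat.cast_pow] at h5
    rw [le_div_iff₀ (by positivity)]
    have h6 : (0 : ℝ) < L * (2 * L + 2) := by positivity
    refine le_of_mul_le_mul_left ?_ h6
    push_cast at h4 h5 ⊢
    calc _ = _ * (L : ℝ) * (2 * L + 2) * (8 * ell (Fintype.card V)) := by ring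
      _ ≤ _ := mul_le_mul_of_nonneg_right h5 (by positivity)
      _ = _ * (8 * ell (Fintype.card V)) * (L : ℝ) ^ m := by ring
      _ ≤ _ := mul_le_mul_of_nonneg_right h4 (by positivity)
  have h4 := Finset.sum_le_card_nsmul _ _ _ h3
  rw [Finset.card_range, nsmul_eq_mul] at h4
  have h5 : ((m - 1 : ℕ) : ℝ) * ((L : ℝ) ^ m / (8 * ell (Fintype.card V))) ≤ (L : ℝ) ^ m / 8 := by
    have h6 : ((m - 1 : ℕ) : ℝ) ≤ ell (Fintype.card V) := by
      rw [Nat.cast_sub hm1]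
      push_cast
      linarith
    have h7 : 0 < (L : ℝ) ^ m := by positivity
    rw [mul_div_assoc', div_le_div_iff₀ (by positivity) (by norm_num)]
    nlinarith
  have h6 : ((_ : ℕ) : ℝ) ≤ ((_ : ℕ) : ℝ) := Nat.cast_le.2 h1
  push_cast at h6 h2
  have h7 : 0 < (L : ℝ) ^ m := by positivity
  linarith

end ExtendColoring

theorem lemma9 {V : Type*} [Fintype V] [DecidableEq V] (G : SimpleGraph V) [DecidableRel G.Adj]
    (χ : ExtendColoring.Coloring V (G.maxDegree + 1))
    (hχ : ExtendColoring.IsPartialColoring G χ)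
    (u v : V) (huv : G.Adj u v) (hunc : χ s(u, v) = none)
    (cu cv : Fin (G.maxDegree + 1))
    (hcu : cu ∈ ExtendColoring.miss χ u) (hcv : cv ∈ ExtendColoring.miss χ v)
    (L : ℕ) (hL : L = ExtendColoring.truncLen (Fintype.card V) G.maxDegree)
    (pick : List (Fin L) → ExtendColoring.Choice (G.maxDegree + 1))
    (hpick : ∀ h p S, S.Nonempty → pick h p S ∈ S)
    {Ω : Type*} [MeasurableSpace Ω] (μ : MeasureTheory.Measure Ω)
    [MeasureTheory.IsProbabilityMeasure μ]
    (X : ℕ → Ω → Fin L) (hmeas : ∀ j, Measurable (X j))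
    (hindep : ProbabilityTheory.iIndepFun X μ)
    (hunif : ∀ j a, μ.real {ω | X j ω = a} = 1 / L) :
    1 / (160 * Real.log (Fintype.card V)) ≤
      μ.real {ω | ∃ m : ℕ, (m : ℝ) ≤ ExtendColoring.ell (Fintype.card V) + 1 ∧
        ExtendColoring.TerminatesWithin pick ⟨χ, u, v, cu, cv⟩ (fun j => X j ω) m} := by
  classical
  have hn : 2 ≤ Fintype.card V := Fintype.one_lt_card_iff.2 ⟨u, v, huv.ne⟩
  have hD : 1 ≤ G.maxDegree :=
    ((G.degree_pos_iff_exists_adj u).2 ⟨v, huv⟩).trans_le (G.degree_le_maxDegree u)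
  have hl := ExtendColoring.ell_ge hn
  have hL3 : 3 ≤ L := by
    have h1 := (ExtendColoring.truncLen_ge (D := G.maxDegree) hn).1
    rw [← hL] at h1
    have h2 : (1 : ℝ) ≤ (G.maxDegree : ℝ) ^ 2 := one_le_pow₀ (by exact_mod_cast hD)
    have h3 : (69 : ℝ) ^ 2 ≤ ExtendColoring.ell (Fintype.card V) ^ 2 :=
      pow_le_pow_left₀ (by norm_num) hl 2
    have h4 : (3 : ℝ) ≤ L := by nlinarith
    exact_mod_cast h4
  have hL0 : 0 < L := by omega
  set s : ExtendColoring.State V (G.maxDegree + 1) := ⟨χ, u, v, cu, cv⟩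
  have hs : s.IsValid G := ⟨hχ, huv, hunc, hcu, hcv⟩
  set m := ⌊ExtendColoring.ell (Fintype.card V) + 1⌋₊
  have hm' : (m : ℝ) ≤ ExtendColoring.ell (Fintype.card V) + 1 := Nat.floor_le (by linarith)
  have hm : ExtendColoring.ell (Fintype.card V) ≤ m := by
    have := Nat.lt_floor_add_one (ExtendColoring.ell (Fintype.card V) + 1)
    linarith
  have hcount := ExtendColoring.two_mul_card_goes_le hL hs (fun h => hpick h) hn hD hL3 hm hm'
  have hprob := ExtendColoring.measureReal_tuple_le hindep hunif
    fun x : Fin m → Fin L => ExtendColoring.Goes pick s (ExtendColoring.extend hL0 x) m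
  set A := {ω | ExtendColoring.Goes pick s
    (ExtendColoring.extend hL0 fun j : Fin m => X j ω) m}
  set E := {ω | ∃ m : ℕ, (m : ℝ) ≤ ExtendColoring.ell (Fintype.card V) + 1 ∧
        ExtendColoring.TerminatesWithin pick s (fun j => X j ω) m}
  have hcover : Set.univ ⊆ E ∪ A := by
    intro ω _
    have hc : ∀ j < m, ExtendColoring.extend hL0 (fun j : Fin m => X j ω) j = X j ω :=
      fun j hj => by simp [ExtendColoring.extend, hj]
    rcases hrun : ExtendColoring.run pick s (fun j => X j ω) m with s' | χ'
    · exact Or.inr ((ExtendColoring.goes_congr hc).2 ⟨s', hrun⟩)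
    · exact Or.inl ⟨m, hm', χ', hrun⟩
  have hsum : 1 ≤ μ.real E + μ.real A := by
    have h1 := MeasureTheory.measureReal_mono (μ := μ) hcover
    rw [MeasureTheory.probReal_univ] at h1
    exact h1.trans (MeasureTheory.measureReal_union_le _ _)
  have hA : μ.real A ≤ 1 / 2 := by
    refine hprob.trans ?_
    have hLm : (0 : ℝ) < (L : ℝ) ^ m := by positivity
    rw [one_div_pow, mul_one_div, div_le_div_iff₀ hLm (by norm_num)]
    linarith
  have hlog : 1 / (160 * Real.log (Fintype.card V)) ≤ 1 / 2 := by
    have : ExtendColoring.ell (Fintype.card V) = 10 ^ 2 * Real.log (Fintype.card V) := rfl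
    exact one_div_le_one_div_of_le (by norm_num) (by linarith)
  linarith
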